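/- Let $m\ge 2$ and $p\ge 1$ be integers, and let $\mathfrak f(m,p)$ be the free $p$-step nilpotent real Lie algebra on $m$ generators, that is, the quotient of the free real Lie algebra on $m$ generators by the ideal spanned by all brackets of more than $p$ elements. Let $\mathfrak g$ be a finite-dimensional real solvable Lie algebra whose nilradical (largest nilpotent ideal) is isomorphic to $\mathfrak f(m,p)$, and let $\langle\cdot,\cdot\rangle$ be an Einstein inner product on $\mathfrak g$, that is, an inner product such that the Ricci tensor of the corresponding left-invariant Riemannian metric satisfies $\mathrm{Ric}=c\,\langle\cdot,\cdot\rangle$ for some constant $c\in\mathbb R$. Then $\langle\cdot,\cdot\rangle$ is standard: the orthogonal complement of the derived algebra $[\mathfrak g,\mathfrak g]$ in $\mathfrak g$ is abelian. -/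

import Mathlib

/-- The nilradical of a Lie algebra: the sum of all ideals that are nilpotent as Lie algebras;
in finite dimension this is the largest nilpotent ideal. (Mathlib's `LieAlgebra.maxNilpotentIdeal`
is the largest ideal on which the whole algebra acts nilpotently, which is a smaller object.) -/
def lieNilradical (R L : Type*) [CommRing R] [LieRing L] [LieAlgebra R L] : LieIdeal R L :=
  sSup {I : LieIdeal R L | LieRing.IsNilpotent I}

/-- The free `p`-step nilpotent real Lie algebra `𝔣(m, p)` on `m` generators: the free Lie algebra
on `m` generators modulo all brackets of more than `p` elements. Since
`lowerCentralSeries _ _ _ 0` is the whole algebra, `lowerCentralSeries _ _ _ p` is spanned by the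
brackets of at least `p + 1` elements. -/
abbrev FreeNilpotentLieAlgebra (m p : ℕ) : Type :=
  FreeLieAlgebra ℝ (Fin m) ⧸
    (LieModule.lowerCentralSeries ℝ (FreeLieAlgebra ℝ (Fin m)) (FreeLieAlgebra ℝ (Fin m)) p)

/-- The bilinear form `B` is an inner product: symmetric and positive definite. -/
structure IsInnerProduct {V : Type*} [AddCommGroup V] [Module ℝ V]
    (B : LinearMap.BilinForm ℝ V) : Prop where
  symm : ∀ x y, B x y = B y x
  pos : ∀ x, x ≠ 0 → 0 < B x x

namespace MetricLieAlgebra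

/-- `D X Y = ∇_X Y`, on left-invariant vector fields, is the Levi-Civita connection of the
left-invariant metric given by `B`: it is torsion free and compatible with the metric. -/
structure IsLeviCivita {g : Type*} [LieRing g] [LieAlgebra ℝ g] (B : LinearMap.BilinForm ℝ g)
    (D : g →ₗ[ℝ] g →ₗ[ℝ] g) : Prop where
  torsion_free : ∀ X Y, D X Y - D Y X = ⁅X, Y⁆
  metric : ∀ X Y Z, B (D X Y) Z + B Y (D X Z) = 0

/-- Every inner product on a finite-dimensional real Lie algebra has exactly one Levi-Civita
connection. -/
theorem existsUnique_isLeviCivita {g : Type*} [LieRing g] [LieAlgebra ℝ g]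
    [FiniteDimensional ℝ g] (B : LinearMap.BilinForm ℝ g) (hB : IsInnerProduct B) :
    ∃! D : g →ₗ[ℝ] g →ₗ[ℝ] g, IsLeviCivita B D := by
  have hnd : B.Nondegenerate := by
    refine ⟨fun x hx => ?_, fun x hx => ?_⟩ <;>
    · by_contra h
      exact (hB.pos x h).ne' (hx x)
  have inj : ∀ u v : g, (∀ w, B u w = B v w) → u = v := by
    intro u v h
    by_contra hne
    have := hB.pos (u - v) (sub_ne_zero.mpr hne)
    simp [h] at this
  have koszul : ∀ D : g →ₗ[ℝ] g →ₗ[ℝ] g, IsLeviCivita B D → ∀ X Y Z,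
      2 * B (D X Y) Z = B ⁅X, Y⁆ Z - B ⁅Y, Z⁆ X + B ⁅Z, X⁆ Y := by
    intro D hD X Y Z
    have h1 := hD.metric X Y Z
    have h2 := hD.metric Y Z X
    have h3 := hD.metric Z X Y
    rw [← hD.torsion_free X Y, ← hD.torsion_free Y Z, ← hD.torsion_free Z X]
    simp only [map_sub, LinearMap.sub_apply]
    rw [hB.symm Y] at h1
    rw [hB.symm Z] at h2
    rw [hB.symm X] at h3
    linarith
  let K : g → g → Module.Dual ℝ g := fun X Y =>
    { toFun := fun Z => (1 / 2 : ℝ) * (B ⁅X, Y⁆ Z - B ⁅Y, Z⁆ X + B ⁅Z, X⁆ Y)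
      map_add' := by
        intro a b
        simp only [lie_add, add_lie, map_add, LinearMap.add_apply]
        ring
      map_smul' := by
        intro a b
        simp only [lie_smul, smul_lie, map_smul, LinearMap.smul_apply, smul_eq_mul,
          RingHom.id_apply]
        ring }
  let E : g →ₗ[ℝ] g →ₗ[ℝ] g := LinearMap.mk₂ ℝ (fun X Y => (B.toDual hnd).symm (K X Y))
    (by
      intro a b Y
      rw [← map_add]
      congr 1
      ext Z
      simp only [K, LinearMap.coe_mk, AddHom.coe_mk, LinearMap.add_apply, lie_add, add_lie,
        map_add]
      ring)
    (by
      intro c X Y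
      rw [← map_smul]
      congr 1
      ext Z
      simp only [K, LinearMap.coe_mk, AddHom.coe_mk, LinearMap.smul_apply, lie_smul, smul_lie,
        map_smul, smul_eq_mul]
      ring)
    (by
      intro X a b
      rw [← map_add]
      congr 1
      ext Z
      simp only [K, LinearMap.coe_mk, AddHom.coe_mk, LinearMap.add_apply, lie_add, add_lie,
        map_add]
      ring)
    (by
      intro c X Y
      rw [← map_smul]
      congr 1
      ext Z
      simp only [K, LinearMap.coe_mk, AddHom.coe_mk, LinearMap.smul_apply, lie_smul, smul_lie,
        map_smul, smul_eq_mul]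
      ring)
  have hE : ∀ X Y Z, B (E X Y) Z = (1 / 2 : ℝ) * (B ⁅X, Y⁆ Z - B ⁅Y, Z⁆ X + B ⁅Z, X⁆ Y) := by
    intro X Y Z
    exact LinearMap.BilinForm.apply_toDual_symm_apply (hB := hnd) (K X Y) Z
  have skew : ∀ X Y Z : g, B ⁅X, Y⁆ Z = - B ⁅Y, X⁆ Z := by
    intro X Y Z
    rw [← lie_skew, map_neg, LinearMap.neg_apply]
  refine ⟨E, ⟨?_, ?_⟩, ?_⟩
  · intro X Y
    apply inj
    intro Z
    rw [map_sub, LinearMap.sub_apply, hE, hE, skew Y X Z, skew X Z Y, skew Z Y X]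
    ring
  · intro X Y Z
    rw [hB.symm Y, hE, hE, skew Z Y X, skew Y X Z, skew Z X Y]
    ring
  · intro D hD
    ext X Y
    apply inj
    intro Z
    have := koszul D hD X Y Z
    rw [hE]
    linarith

/-- The linear map `Z ↦ R(Z, X) Y`, where
`R(Z, X) Y = ∇_Z ∇_X Y - ∇_X ∇_Z Y - ∇_[Z, X] Y` is the curvature tensor of `D = ∇`. -/
def curvature {g : Type*} [LieRing g] [LieAlgebra ℝ g] (D : g →ₗ[ℝ] g →ₗ[ℝ] g) (X Y : g) :
    g →ₗ[ℝ] g where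
  toFun Z := D Z (D X Y) - D X (D Z Y) - D ⁅Z, X⁆ Y
  map_add' a b := by
    simp only [map_add, add_lie, LinearMap.add_apply]
    abel
  map_smul' c a := by
    simp only [map_smul, smul_lie, LinearMap.smul_apply, RingHom.id_apply, smul_sub]

/-- The Ricci tensor `Ric(X, Y) = Tr (Z ↦ R(Z, X) Y)` of the connection `D`. -/
noncomputable def ricci {g : Type*} [LieRing g] [LieAlgebra ℝ g] (D : g →ₗ[ℝ] g →ₗ[ℝ] g)
    (X Y : g) : ℝ :=
  LinearMap.trace ℝ g (curvature D X Y)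

/-- The inner product `B` on the Lie algebra `g` is Einstein: the Ricci tensor of its Levi-Civita
connection is a constant multiple of `B`. -/
def IsEinstein {g : Type*} [LieRing g] [LieAlgebra ℝ g] (B : LinearMap.BilinForm ℝ g) : Prop :=
  ∃ D : g →ₗ[ℝ] g →ₗ[ℝ] g, IsLeviCivita B D ∧ ∃ c : ℝ, ∀ X Y, ricci D X Y = c * B X Y

/-- The inner product `B` on the Lie algebra `g` is standard: the orthogonal complement to the
derived algebra `[g, g]` is abelian. -/
def IsStandard {g : Type*} [LieRing g] [LieAlgebra ℝ g] (B : LinearMap.BilinForm ℝ g) : Prop :=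
  ∀ X ∈ B.orthogonal (LieAlgebra.derivedSeries ℝ g 1).toSubmodule,
    ∀ Y ∈ B.orthogonal (LieAlgebra.derivedSeries ℝ g 1).toSubmodule, ⁅X, Y⁆ = 0

end MetricLieAlgebra

/-!
Let `n` be the nilradical of `g`, let `H` be the mean curvature vector, `⟨H, X⟩ = tr ad X`, and
let `c` be the Einstein constant. By Lie's theorem `[g, g] ⊆ n`
(`derivedSeries_one_le_lieNilradical`), so the lower central series of `n`, preceded by `g`, is a
filtration `F` of `g` with `[F i, F j] ⊆ F (i + j)` and `[g, g] ⊆ F 1 = n`. Choose an orthonormal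
basis `b` with degrees `w` adapted to it, and let `W` be the diagonal operator with entries `w`.
The structure constant `⟨[b i, b j], b k⟩` vanishes unless `w k ≥ max 1 (w i + w j)`.

The Ricci operator is the sum of the moment map of the Lie bracket, `-1/2` times the Killing form
and minus the symmetric part of `ad H`; the Killing form is zero on `n`. The Einstein equation is
paired with two operators.

* With `W` the moment map contributes `∑ (w k - w i - w j) ⟨[b i, b j], b k⟩² / 4`, which is
  nonnegative by the vanishing above (`IsAdapted.sum_weight_mul_sq_eq`). Hence
  `c tr W + tr (ad H W) ≥ 0`, and equality forces the orthogonal complement of `n` to be abelian.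
* With the derivation `ad H` the moment map contributes nothing, so that the symmetric part `S` of
  `ad H` satisfies `|S|² = -c tr ad H` (`sum_sq_symm_ad_eq`).

That `n` is free nilpotent enters through traces. Modulo derivations that lower the filtration, a
derivation of `n` is given by a matrix acting on the generators, and `A ↦ tr A` and
`A ↦ tr (A W)` kill commutators of matrices, so they are proportional to the trace of the matrix.
Comparison with the degree derivation gives a number `t` with `tr ad H = t tr W` and
`tr (ad H W) = t tr W²` (`IsAdapted.exists_trace_eq`).

If `H ≠ 0`, then `t > 0` because `tr ad H = |H|²`, and
`0 ≤ |S - t W|² = -t (c tr W + t tr W²) ≤ 0`. So the complement of `n` is abelian and `S = t W` is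
positive definite on `n`, whence `ad H` is invertible on `n` and `[g, g] = n`
(`IsAdapted.isStandard_of_trace_eq`). If `H = 0`, the pairing with `W` gives `c ≥ 0`, while the
Ricci curvature in directions orthogonal to `n` is nonpositive; the resulting equalities make `n`
and its complement abelian, with the complement acting by skew-symmetric operators
(`IsAdapted.isStandard_of_unimodular`).
-/

open LieModule

/-! ### The derived algebra of a solvable Lie algebra lies in the nilradical -/

/-- A consequence of Lie's theorem: over an algebraically closed field of characteristic zero,
brackets in a solvable Lie algebra act nilpotently on every finite-dimensional module. -/
theorem isNilpotent_toEnd_of_mem_derivedSeries_one {k : Type*} [Field k] [CharZero k]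
    [IsAlgClosed k] {L : Type*} [LieRing L] [LieAlgebra k L] [LieAlgebra.IsSolvable L]
    (z : L) (hz : z ∈ LieAlgebra.derivedSeries k L 1) (d : ℕ) :
    ∀ (V : Type*) [AddCommGroup V] [Module k V] [LieRingModule L V] [LieModule k L V]
      [Module.Finite k V], Module.finrank k V = d → IsNilpotent (LieModule.toEnd k L V z) := by
  induction d using Nat.strong_induction_on with
  | _ d ih =>
  intro V _ _ _ _ _ hd
  rcases subsingleton_or_nontrivial V with hV | hV
  · exact ⟨1, by ext v; exact Subsingleton.elim _ _⟩
  obtain ⟨χ, hχ⟩ := LieModule.exists_nontrivial_weightSpace_of_isSolvable k L V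
  obtain ⟨⟨v, hv⟩, hv0⟩ := exists_ne (0 : LieModule.weightSpace V χ)
  have hv0 : v ≠ 0 := fun h => hv0 (Subtype.ext h)
  have hv : ∀ x : L, ⁅x, v⁆ = χ x • v := (LieModule.mem_weightSpace _ _).mp hv
  -- A weight is a one-dimensional representation, so it kills brackets.
  have hz0 : χ z = 0 := by
    have hle : (LieAlgebra.derivedSeries k L 1).toSubmodule ≤ LinearMap.ker χ := by
      rw [LieAlgebra.derivedSeries_def, LieAlgebra.derivedSeriesOfIdeal_succ,
        LieSubmodule.lieIdeal_oper_eq_linear_span', Submodule.span_le]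
      rintro _ ⟨x, -, y, -, rfl⟩
      have h : χ ⁅x, y⁆ • v = 0 := by
        rw [← hv, lie_lie, hv, hv, lie_smul, lie_smul, hv, hv, smul_smul, smul_smul, mul_comm,
          sub_self]
      exact (smul_eq_zero.mp h).resolve_right hv0
    exact hle hz
  let W : LieSubmodule k L V :=
    { toSubmodule := k ∙ v
      lie_mem := by
        intro x u hu
        obtain ⟨a, rfl⟩ := Submodule.mem_span_singleton.mp hu
        rw [lie_smul, hv]
        exact Submodule.smul_mem _ _ (Submodule.smul_mem _ _ (Submodule.mem_span_singleton_self v)) }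
  have hlt : Module.finrank k (V ⧸ W) < d := by
    have h1 : Module.finrank k (V ⧸ W.toSubmodule) + Module.finrank k W.toSubmodule
        = Module.finrank k V := Submodule.finrank_quotient_add_finrank _
    have h2 : Module.finrank k W.toSubmodule = 1 := finrank_span_singleton hv0
    have h3 : Module.finrank k (V ⧸ W) = Module.finrank k (V ⧸ W.toSubmodule) := rfl
    omega
  have : Module.Finite k (V ⧸ W) := inferInstanceAs (Module.Finite k (V ⧸ W.toSubmodule))
  obtain ⟨n, hn⟩ := ih _ hlt (V ⧸ W) rfl
  refine ⟨n + 1, ?_⟩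
  have hmk : ∀ (j : ℕ) (u : V), LieSubmodule.Quotient.mk (N := W) ((LieModule.toEnd k L V z ^ j) u)
      = (LieModule.toEnd k L (V ⧸ W) z ^ j) (LieSubmodule.Quotient.mk u) := by
    intro j
    induction j with
    | zero => intro u; simp
    | succ j hj => intro u; rw [pow_succ, pow_succ]; exact hj _
  ext u
  have hu : (LieModule.toEnd k L V z ^ n) u ∈ W := by
    rw [← LieSubmodule.Quotient.mk_eq_zero', hmk, hn, LinearMap.zero_apply]
  obtain ⟨a, ha⟩ := Submodule.mem_span_singleton.mp hu
  rw [pow_succ', Module.End.mul_apply, ← ha, LieModule.toEnd_apply_apply, lie_smul, hv, hz0]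
  simp

theorem derivedSeries_one_le_lieNilradical {g : Type*} [LieRing g] [LieAlgebra ℝ g]
    [FiniteDimensional ℝ g] [LieAlgebra.IsSolvable g] :
    LieAlgebra.derivedSeries ℝ g 1 ≤ lieNilradical ℝ g := by
  refine le_sSup ?_
  have key : ∀ z ∈ LieAlgebra.derivedSeries ℝ g 1, IsNilpotent (LieAlgebra.ad ℝ g z) := by
    intro z hz
    -- Lie's theorem needs an algebraically closed field, hence the passage to `ℂ ⊗ g`.
    have hz' : (1 : ℂ) ⊗ₜ[ℝ] z ∈ LieAlgebra.derivedSeries ℂ (TensorProduct ℝ ℂ g) 1 := by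
      rw [LieAlgebra.derivedSeries_baseChange]
      exact LieSubmodule.tmul_mem_baseChange_of_mem 1 hz
    obtain ⟨n, hn⟩ := isNilpotent_toEnd_of_mem_derivedSeries_one _ hz' _ (TensorProduct ℝ ℂ g) rfl
    refine ⟨n, ?_⟩
    have hmk : ∀ (j : ℕ) (u : g),
        (LieModule.toEnd ℂ (TensorProduct ℝ ℂ g) (TensorProduct ℝ ℂ g) (1 ⊗ₜ[ℝ] z) ^ j)
          ((1 : ℂ) ⊗ₜ[ℝ] u) = 1 ⊗ₜ[ℝ] ((LieAlgebra.ad ℝ g z ^ j) u) := by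
      intro j
      induction j with
      | zero => intro u; simp
      | succ j hj =>
        intro u
        rw [pow_succ, pow_succ, Module.End.mul_apply, Module.End.mul_apply, ← hj]
        simp
    ext u
    have h := hmk n u
    rw [hn, LinearMap.zero_apply] at h
    have hinj : Function.Injective (fun u : g => (1 : ℂ) ⊗ₜ[ℝ] u) :=
      Module.FaithfullyFlat.tensorProduct_mk_injective (A := ℝ) (B := ℂ) g
    exact hinj (by simpa using h.symm)
  -- Engel's theorem.
  rw [Set.mem_ofPred_eq, LieAlgebra.isNilpotent_iff_forall (R := ℝ)]
  intro x
  obtain ⟨n, hn⟩ := key x x.2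
  refine ⟨n, ?_⟩
  have hcoe : ∀ (j : ℕ) (u : LieAlgebra.derivedSeries ℝ g 1),
      (((LieAlgebra.ad ℝ _ x ^ j) u : LieAlgebra.derivedSeries ℝ g 1) : g)
        = (LieAlgebra.ad ℝ g x ^ j) u := by
    intro j
    induction j with
    | zero => intro u; simp
    | succ j hj => intro u; rw [pow_succ, pow_succ]; exact hj _
  ext u
  rw [hcoe, hn]
  simp

/-! ### Derivations and the lower central series -/

section LowerCentralSeries

variable {R N : Type*} [CommRing R] [LieRing N] [LieAlgebra R N]

theorem lowerCentralSeries_succ_le {W : Submodule R N} {k : ℕ}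
    (h : ∀ x : N, ∀ y ∈ lowerCentralSeries R N N k, ⁅x, y⁆ ∈ W) :
    (lowerCentralSeries R N N (k + 1)).toSubmodule ≤ W := by
  rw [lowerCentralSeries_succ, LieSubmodule.lieIdeal_oper_eq_linear_span', Submodule.span_le]
  rintro _ ⟨x, -, y, hy, rfl⟩
  exact h x y hy

theorem lie_mem_lowerCentralSeries_succ {k : ℕ} (x : N) {y : N}
    (hy : y ∈ lowerCentralSeries R N N k) : ⁅x, y⁆ ∈ lowerCentralSeries R N N (k + 1) := by
  rw [lowerCentralSeries_succ]
  exact LieSubmodule.lie_mem_lie (LieSubmodule.mem_top x) hy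

theorem lie_mem_lowerCentralSeries_add {a b : ℕ} {x y : N}
    (hx : x ∈ lowerCentralSeries R N N a) (hy : y ∈ lowerCentralSeries R N N b) :
    ⁅x, y⁆ ∈ lowerCentralSeries R N N (a + b + 1) := by
  induction a generalizing b x y with
  | zero => rw [zero_add]; exact lie_mem_lowerCentralSeries_succ x hy
  | succ a ih =>
    let W : Submodule R N :=
      (lowerCentralSeries R N N (a + 1 + b + 1)).toSubmodule.comap
        ((toEnd R N N : N →ₗ[R] N →ₗ[R] N).flip y)
    refine lowerCentralSeries_succ_le (W := W) (fun u x' hx' => ?_) hx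
    change ⁅⁅u, x'⁆, y⁆ ∈ lowerCentralSeries R N N (a + 1 + b + 1)
    rw [lie_lie]
    refine sub_mem ?_ ?_
    · have := lie_mem_lowerCentralSeries_succ u (ih hx' hy)
      convert this using 2
      omega
    · convert ih hx' (lie_mem_lowerCentralSeries_succ u hy) using 2
      omega

namespace LieDerivation

theorem toLinearMap_finset_sum {ι : Type*} (s : Finset ι) (D : ι → LieDerivation R N N) :
    (∑ i ∈ s, D i).toLinearMap = ∑ i ∈ s, (D i).toLinearMap :=
  map_sum (toLinearMapLieHom R N) D s

theorem finset_sum_apply {ι : Type*} (s : Finset ι) (D : ι → LieDerivation R N N) (x : N) :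
    (∑ i ∈ s, D i) x = ∑ i ∈ s, D i x := by
  rw [← coeFn_coe, toLinearMap_finset_sum, LinearMap.sum_apply]
  rfl

variable (D : LieDerivation R N N)

theorem apply_mem_lowerCentralSeries {k : ℕ} {x : N}
    (hx : x ∈ lowerCentralSeries R N N k) : D x ∈ lowerCentralSeries R N N k := by
  induction k generalizing x with
  | zero => simp
  | succ k ih =>
    refine lowerCentralSeries_succ_le
      (W := (lowerCentralSeries R N N (k + 1)).toSubmodule.comap D.toLinearMap)
      (fun u y hy => ?_) hx
    change D ⁅u, y⁆ ∈ lowerCentralSeries R N N (k + 1)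
    rw [apply_lie_eq_add]
    exact add_mem (lie_mem_lowerCentralSeries_succ _ (ih hy))
      (lie_mem_lowerCentralSeries_succ _ hy)

/-- A derivation that vanishes on the abelianization lowers the filtration by the lower central
series by at least one step. -/
theorem apply_mem_lowerCentralSeries_succ (hD : ∀ x, D x ∈ lowerCentralSeries R N N 1) {k : ℕ}
    {x : N} (hx : x ∈ lowerCentralSeries R N N k) : D x ∈ lowerCentralSeries R N N (k + 1) := by
  induction k generalizing x with
  | zero => exact hD x
  | succ k ih =>
    refine lowerCentralSeries_succ_le
      (W := (lowerCentralSeries R N N (k + 2)).toSubmodule.comap D.toLinearMap)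
      (fun u y hy => ?_) hx
    change D ⁅u, y⁆ ∈ lowerCentralSeries R N N (k + 2)
    rw [apply_lie_eq_sub]
    exact sub_mem (lie_mem_lowerCentralSeries_succ _ (ih hy))
      (lie_mem_lowerCentralSeries_add hy (hD u))

/-- A derivation that is the identity on the abelianization is multiplication by `k + 1` on the
`k`-th factor of the lower central series. -/
theorem apply_sub_smul_mem_lowerCentralSeries_succ
    (hD : ∀ x, D x - x ∈ lowerCentralSeries R N N 1) {k : ℕ}
    {x : N} (hx : x ∈ lowerCentralSeries R N N k) :
    D x - ((k : R) + 1) • x ∈ lowerCentralSeries R N N (k + 1) := by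
  induction k generalizing x with
  | zero => simpa using hD x
  | succ k ih =>
    refine lowerCentralSeries_succ_le
      (W := (lowerCentralSeries R N N (k + 2)).toSubmodule.comap
        (D.toLinearMap - (((k + 1 : ℕ) : R) + 1) • LinearMap.id))
      (fun u y hy => ?_) hx
    change D ⁅u, y⁆ - (((k + 1 : ℕ) : R) + 1) • ⁅u, y⁆ ∈ lowerCentralSeries R N N (k + 2)
    have h : D ⁅u, y⁆ - (((k + 1 : ℕ) : R) + 1) • ⁅u, y⁆
        = ⁅u, D y - ((k : R) + 1) • y⁆ - ⁅y, D u - u⁆ := by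
      rw [apply_lie_eq_sub, lie_sub, lie_sub, lie_smul, ← lie_skew y u, Nat.cast_succ]
      module
    rw [h]
    exact sub_mem (lie_mem_lowerCentralSeries_succ _ (ih hy))
      (lie_mem_lowerCentralSeries_add hy (hD u))

end LieDerivation

theorem apply_mem_lowerCentralSeries_one_of_generators {σ : Type*} {x : σ → N}
    (hgen : Submodule.span R (Set.range x) ⊔ (lowerCentralSeries R N N 1).toSubmodule = ⊤)
    (T : N →ₗ[R] N) (hT : ∀ y ∈ lowerCentralSeries R N N 1, T y ∈ lowerCentralSeries R N N 1)
    (hx : ∀ i, T (x i) ∈ lowerCentralSeries R N N 1) (y : N) :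
    T y ∈ lowerCentralSeries R N N 1 := by
  have hle : (⊤ : Submodule R N) ≤ (lowerCentralSeries R N N 1).toSubmodule.comap T := by
    rw [← hgen, sup_le_iff, Submodule.span_le]
    refine ⟨?_, hT⟩
    rintro _ ⟨i, rfl⟩
    exact hx i
  exact hle trivial

end LowerCentralSeries

/-! ### Traces of derivations of algebras with freely prescribable derivations -/

section WeightedTrace

variable {N κ : Type*} [LieRing N] [LieAlgebra ℝ N] [Fintype κ]

/-- The weighted trace `∑ θ(v i) Aᵢᵢ` of an endomorphism `A` with respect to a basis `e` with
coordinate functionals `f`, whose members carry the degrees `v`. -/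
def weightedTrace (e : κ → N) (f : κ → N →ₗ[ℝ] ℝ) (v : κ → ℕ) (θ : ℕ → ℝ)
    (A : N →ₗ[ℝ] N) : ℝ :=
  ∑ i, θ (v i) * f i (A (e i))

variable {e : κ → N} {f : κ → N →ₗ[ℝ] ℝ} {v : κ → ℕ} {θ : ℕ → ℝ}

theorem weightedTrace_add (A B : N →ₗ[ℝ] N) :
    weightedTrace e f v θ (A + B) = weightedTrace e f v θ A + weightedTrace e f v θ B := by
  simp [weightedTrace, mul_add, Finset.sum_add_distrib]

theorem weightedTrace_smul (c : ℝ) (A : N →ₗ[ℝ] N) :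
    weightedTrace e f v θ (c • A) = c * weightedTrace e f v θ A := by
  simp [weightedTrace, Finset.mul_sum, mul_left_comm]

theorem weightedTrace_sub (A B : N →ₗ[ℝ] N) :
    weightedTrace e f v θ (A - B) = weightedTrace e f v θ A - weightedTrace e f v θ B := by
  simp [weightedTrace, mul_sub, Finset.sum_sub_distrib]

theorem weightedTrace_sum {σ : Type*} (s : Finset σ) (A : σ → N →ₗ[ℝ] N) :
    weightedTrace e f v θ (∑ j ∈ s, A j) = ∑ j ∈ s, weightedTrace e f v θ (A j) := by
  simp only [weightedTrace, LinearMap.sum_apply, map_sum, Finset.mul_sum]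
  exact Finset.sum_comm

theorem weightedTrace_eq_zero_of_lowering
    (hmem : ∀ i, e i ∈ lowerCentralSeries ℝ N N (v i))
    (hf : ∀ i k, ∀ x ∈ lowerCentralSeries ℝ N N k, v i < k → f i x = 0)
    (A : N →ₗ[ℝ] N)
    (hA : ∀ k, ∀ x ∈ lowerCentralSeries ℝ N N k, A x ∈ lowerCentralSeries ℝ N N (k + 1)) :
    weightedTrace e f v θ A = 0 :=
  Finset.sum_eq_zero fun i _ => by
    rw [hf i _ _ (hA _ _ (hmem i)) (Nat.lt_succ_self _), mul_zero]

/-- Weighted traces vanish on commutators of endomorphisms that preserve the lower central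
series, because such endomorphisms are block triangular and `θ` is constant on the diagonal
blocks. -/
theorem weightedTrace_comp_comm (hexp : ∀ x, ∑ i, f i x • e i = x)
    (hmem : ∀ i, e i ∈ lowerCentralSeries ℝ N N (v i))
    (hf : ∀ i k, ∀ x ∈ lowerCentralSeries ℝ N N k, v i < k → f i x = 0)
    (A B : N →ₗ[ℝ] N)
    (hA : ∀ k, ∀ x ∈ lowerCentralSeries ℝ N N k, A x ∈ lowerCentralSeries ℝ N N k)
    (hB : ∀ k, ∀ x ∈ lowerCentralSeries ℝ N N k, B x ∈ lowerCentralSeries ℝ N N k) :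
    weightedTrace e f v θ (A ∘ₗ B) = weightedTrace e f v θ (B ∘ₗ A) := by
  have hexpand : ∀ A B : N →ₗ[ℝ] N, weightedTrace e f v θ (A ∘ₗ B)
      = ∑ i, ∑ j, θ (v i) * (f j (B (e i)) * f i (A (e j))) := by
    intro A B
    refine Finset.sum_congr rfl fun i _ => ?_
    rw [LinearMap.comp_apply, ← Finset.mul_sum]
    conv_lhs => rw [← hexp (B (e i))]
    simp
  rw [hexpand, hexpand, Finset.sum_comm]
  refine Finset.sum_congr rfl fun j _ => Finset.sum_congr rfl fun i _ => ?_
  rcases lt_trichotomy (v i) (v j) with h | h | h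
  · rw [hf i _ _ (hA _ _ (hmem j)) h]
    ring
  · rw [h]
    ring
  · rw [hf j _ _ (hB _ _ (hmem i)) h]
    ring

/-- Suppose that derivations of `N` can be prescribed arbitrarily on a family `x` which spans `N`
modulo `[N, N]`, as is the case for free nilpotent Lie algebras. Then all weighted traces of a
derivation are proportional to those of the derivation that is the identity on the family: modulo
derivations which lower the filtration, a derivation comes from a matrix, and a linear functional
on matrices that kills commutators is a multiple of the trace. -/
theorem exists_weightedTrace_eq {σ : Type*} [Fintype σ] [Nonempty σ]
    (hexp : ∀ x, ∑ i, f i x • e i = x) (hone : ∀ i, f i (e i) = 1)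
    (hmem : ∀ i, e i ∈ lowerCentralSeries ℝ N N (v i))
    (hf : ∀ i k, ∀ x ∈ lowerCentralSeries ℝ N N k, v i < k → f i x = 0)
    (x : σ → N)
    (hgen : Submodule.span ℝ (Set.range x) ⊔ (lowerCentralSeries ℝ N N 1).toSubmodule = ⊤)
    (hext : ∀ y : σ → N, ∃ D : LieDerivation ℝ N N, ∀ i, D (x i) = y i)
    (A : LieDerivation ℝ N N) :
    ∃ t : ℝ, ∀ θ : ℕ → ℝ, ∑ i, θ (v i) * f i (A (e i)) = t * ∑ i, θ (v i) * ((v i : ℝ) + 1) := by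
  classical
  have hpres : ∀ (D : LieDerivation ℝ N N) (k : ℕ), ∀ y ∈ lowerCentralSeries ℝ N N k,
      D.toLinearMap y ∈ lowerCentralSeries ℝ N N k :=
    fun D k y hy => D.apply_mem_lowerCentralSeries hy
  -- Only the values on the generators modulo `[N, N]` matter.
  have hzero : ∀ (θ : ℕ → ℝ) (D : LieDerivation ℝ N N),
      (∀ i, D (x i) ∈ lowerCentralSeries ℝ N N 1) → weightedTrace e f v θ D.toLinearMap = 0 := by
    intro θ D hD
    refine weightedTrace_eq_zero_of_lowering hmem hf _ fun k y hy => ?_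
    exact D.apply_mem_lowerCentralSeries_succ
      (apply_mem_lowerCentralSeries_one_of_generators hgen D.toLinearMap
        (hpres D 1) hD) hy
  choose D hD using fun i j : σ => hext (Pi.single i (x j))
  choose φ hφ using hext x
  -- The matrix by which `A` acts on the generators modulo `[N, N]`; it need not be unique.
  have hcoord : ∀ i, ∃ c : σ → ℝ, A (x i) - ∑ j, c j • x j ∈ lowerCentralSeries ℝ N N 1 := by
    intro i
    have hi : A (x i) ∈ Submodule.span ℝ (Set.range x) ⊔
        (lowerCentralSeries ℝ N N 1).toSubmodule := hgen ▸ Submodule.mem_top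
    obtain ⟨a, ha, b, hb, hab⟩ := Submodule.mem_sup.mp hi
    obtain ⟨c, rfl⟩ := (Submodule.mem_span_range_iff_exists_fun ℝ).mp ha
    exact ⟨c, by rw [← hab, add_sub_cancel_left]; exact hb⟩
  choose M hM using hcoord
  -- Up to derivations vanishing on the generators, `[D i i, D i j] = -D i j` for `i ≠ j`.
  have hoff : ∀ θ : ℕ → ℝ, ∀ i j, i ≠ j → weightedTrace e f v θ (D i j).toLinearMap = 0 := by
    intro θ i j hij
    have h1 := hzero θ (⁅D i i, D i j⁆ + D i j) (by
      intro k
      rw [LieDerivation.add_apply, LieDerivation.commutator_apply, hD, hD]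
      by_cases hk : k = i
      · subst hk
        simp [hD, hij]
      · simp [hk])
    rw [LieDerivation.coe_add_linearMap, weightedTrace_add,
      LieDerivation.commutator_coe_linear_map, LieRing.of_associative_ring_bracket,
      weightedTrace_sub] at h1
    have h2 := weightedTrace_comp_comm (θ := θ) hexp hmem hf _ _ (hpres (D i i)) (hpres (D i j))
    simp only [Module.End.mul_eq_comp] at h1
    linarith
  -- Up to derivations vanishing on the generators, `[D i j, D j i] = D j j - D i i`.
  have hdiag : ∀ θ : ℕ → ℝ, ∀ i j, weightedTrace e f v θ (D i i).toLinearMap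
      = weightedTrace e f v θ (D j j).toLinearMap := by
    intro θ i j
    by_cases hij : i = j
    · rw [hij]
    have h1 := hzero θ (⁅D i j, D j i⁆ + D i i - D j j) (by
      intro k
      rw [LieDerivation.sub_apply, LieDerivation.add_apply, LieDerivation.commutator_apply,
        hD, hD, hD, hD]
      by_cases hk : k = i
      · subst hk
        simp [hD, hij]
      · by_cases hk' : k = j
        · subst hk'
          simp [hD, hk]
        · simp [hk, hk'])
    rw [LieDerivation.coe_sub_linearMap, weightedTrace_sub, LieDerivation.coe_add_linearMap,
      weightedTrace_add, LieDerivation.commutator_coe_linear_map,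
      LieRing.of_associative_ring_bracket, weightedTrace_sub] at h1
    have h2 := weightedTrace_comp_comm (θ := θ) hexp hmem hf _ _ (hpres (D i j)) (hpres (D j i))
    simp only [Module.End.mul_eq_comp] at h1
    linarith
  have hφtrace : ∀ θ : ℕ → ℝ, weightedTrace e f v θ φ.toLinearMap
      = ∑ i, θ (v i) * ((v i : ℝ) + 1) := by
    intro θ
    have hφ1 : ∀ y, φ y - y ∈ lowerCentralSeries ℝ N N 1 :=
      apply_mem_lowerCentralSeries_one_of_generators hgen
        (φ.toLinearMap - LinearMap.id) (fun y hy => sub_mem (hpres φ 1 y hy) hy)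
        (fun i => by simp [hφ])
    refine Finset.sum_congr rfl fun i _ => ?_
    have h := hf i _ _ (φ.apply_sub_smul_mem_lowerCentralSeries_succ hφ1 (hmem i))
      (Nat.lt_succ_self _)
    rw [map_sub, map_smul, hone, smul_eq_mul, mul_one, sub_eq_zero] at h
    rw [← h]
    rfl
  have hsumφ : ∀ θ : ℕ → ℝ, weightedTrace e f v θ φ.toLinearMap
      = ∑ i, weightedTrace e f v θ (D i i).toLinearMap := by
    intro θ
    have h1 := hzero θ (φ - ∑ i, D i i) (by
      intro k
      rw [LieDerivation.sub_apply, LieDerivation.finset_sum_apply, hφ]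
      simp [hD, Pi.single_apply])
    rw [LieDerivation.coe_sub_linearMap, weightedTrace_sub, LieDerivation.toLinearMap_finset_sum,
      weightedTrace_sum] at h1
    linarith
  have hsumA : ∀ θ : ℕ → ℝ, weightedTrace e f v θ A.toLinearMap
      = ∑ i, ∑ j, M i j * weightedTrace e f v θ (D i j).toLinearMap := by
    intro θ
    have h1 := hzero θ (A - ∑ i, ∑ j, M i j • D i j) (by
      intro k
      simp only [LieDerivation.sub_apply, LieDerivation.finset_sum_apply,
        LieDerivation.smul_apply]
      convert hM k using 2
      rw [Finset.sum_eq_single k]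
      · simp [hD]
      · intro b _ hb
        simp [hD, hb.symm]
      · simp)
    simp only [LieDerivation.coe_sub_linearMap, weightedTrace_sub,
      LieDerivation.toLinearMap_finset_sum, LieDerivation.coe_smul_linearMap, weightedTrace_sum,
      weightedTrace_smul] at h1
    linarith
  obtain ⟨o⟩ := ‹Nonempty σ›
  refine ⟨(∑ i, M i i) / Fintype.card σ, fun θ => ?_⟩
  have hcard : (Fintype.card σ : ℝ) ≠ 0 := by
    have : Nonempty σ := ⟨o⟩
    exact_mod_cast Fintype.card_ne_zero
  rw [← hφtrace, hsumφ, Finset.sum_congr rfl (fun i _ => hdiag θ i o), Finset.sum_const,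
    Finset.card_univ, nsmul_eq_mul, ← mul_assoc, div_mul_cancel₀ _ hcard, Finset.sum_mul]
  refine (hsumA θ).trans (Finset.sum_congr rfl fun i _ => ?_)
  rw [Finset.sum_eq_single i, hdiag θ i o]
  · intro j _ hj
    rw [hoff θ i j hj.symm, mul_zero]
  · simp

end WeightedTrace

/-! ### Derivations of free nilpotent Lie algebras -/

/-- The Lie algebra `N ⊗ ℝ[ε]` of dual numbers over `N`, realized on pairs `(x, u)`, which stand
for `x + ε u`. Homomorphisms into it are homomorphisms `π` into `N` together with a derivation
along `π`. -/
def DualLieAlgebra (N : Type*) : Type _ := N × N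

namespace DualLieAlgebra

variable {N : Type*} [LieRing N] [LieAlgebra ℝ N]

/-- The element `x + ε u`. -/
def mk {N : Type*} (x u : N) : DualLieAlgebra N := (x, u)

instance : AddCommGroup (DualLieAlgebra N) := inferInstanceAs (AddCommGroup (N × N))

instance : Module ℝ (DualLieAlgebra N) := inferInstanceAs (Module ℝ (N × N))

instance : LieRing (DualLieAlgebra N) where
  bracket a b := (⁅a.1, b.1⁆, ⁅a.1, b.2⁆ + ⁅a.2, b.1⁆)
  add_lie a b c := Prod.ext (add_lie a.1 b.1 c.1) (by
    change ⁅a.1 + b.1, c.2⁆ + ⁅a.2 + b.2, c.1⁆ = ⁅a.1, c.2⁆ + ⁅a.2, c.1⁆ + (⁅b.1, c.2⁆ + ⁅b.2, c.1⁆)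
    simp only [add_lie]
    abel)
  lie_add a b c := Prod.ext (lie_add a.1 b.1 c.1) (by
    change ⁅a.1, b.2 + c.2⁆ + ⁅a.2, b.1 + c.1⁆ = ⁅a.1, b.2⁆ + ⁅a.2, b.1⁆ + (⁅a.1, c.2⁆ + ⁅a.2, c.1⁆)
    simp only [lie_add]
    abel)
  lie_self a := Prod.ext (lie_self a.1) (by
    change ⁅a.1, a.2⁆ + ⁅a.2, a.1⁆ = 0
    rw [← lie_skew, neg_add_cancel])
  leibniz_lie a b c := Prod.ext (leibniz_lie a.1 b.1 c.1) (by
    change ⁅a.1, ⁅b.1, c.2⁆ + ⁅b.2, c.1⁆⁆ + ⁅a.2, ⁅b.1, c.1⁆⁆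
      = ⁅⁅a.1, b.1⁆, c.2⁆ + ⁅⁅a.1, b.2⁆ + ⁅a.2, b.1⁆, c.1⁆
        + (⁅b.1, ⁅a.1, c.2⁆ + ⁅a.2, c.1⁆⁆ + ⁅b.2, ⁅a.1, c.1⁆⁆)
    simp only [lie_add, add_lie, leibniz_lie a.1, leibniz_lie a.2]
    abel)

instance : LieAlgebra ℝ (DualLieAlgebra N) where
  lie_smul t a b := Prod.ext (lie_smul t a.1 b.1) (by
    change ⁅a.1, t • b.2⁆ + ⁅a.2, t • b.1⁆ = t • (⁅a.1, b.2⁆ + ⁅a.2, b.1⁆)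
    simp only [lie_smul, smul_add])

variable (N) in
/-- The projection `x + ε u ↦ x`. -/
def fstHom : DualLieAlgebra N →ₗ⁅ℝ⁆ N :=
  { LinearMap.fst ℝ N N with map_lie' := rfl }

end DualLieAlgebra

namespace FreeNilpotentLieAlgebra

variable (m p : ℕ)

/-- The projection of the free Lie algebra onto the free nilpotent one. -/
noncomputable def mkHom : FreeLieAlgebra ℝ (Fin m) →ₗ⁅ℝ⁆ FreeNilpotentLieAlgebra m p where
  toLinearMap := (lowerCentralSeries ℝ (FreeLieAlgebra ℝ (Fin m))
    (FreeLieAlgebra ℝ (Fin m)) p).toSubmodule.mkQ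
  map_lie' := fun {x y} => LieSubmodule.Quotient.mk_bracket _ x y

/-- The generators of the free nilpotent Lie algebra. -/
noncomputable def gen (i : Fin m) : FreeNilpotentLieAlgebra m p := mkHom m p (FreeLieAlgebra.of ℝ i)

theorem mkHom_surjective : Function.Surjective (mkHom m p) :=
  Submodule.mkQ_surjective _

theorem mkHom_eq_zero_iff (x : FreeLieAlgebra ℝ (Fin m)) :
    mkHom m p x = 0 ↔ x ∈ lowerCentralSeries ℝ (FreeLieAlgebra ℝ (Fin m)) _ p :=
  Submodule.Quotient.mk_eq_zero _

theorem lowerCentralSeries_eq_bot :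
    lowerCentralSeries ℝ (FreeNilpotentLieAlgebra m p) (FreeNilpotentLieAlgebra m p) p = ⊥ := by
  rw [← LieIdeal.lowerCentralSeries_map_eq p (mkHom_surjective m p), LieIdeal.map_eq_bot_iff]
  intro x hx
  exact (mkHom_eq_zero_iff m p x).mpr hx

theorem span_gen_sup_lowerCentralSeries_one :
    Submodule.span ℝ (Set.range (gen m p)) ⊔
      (lowerCentralSeries ℝ (FreeNilpotentLieAlgebra m p) _ 1).toSubmodule = ⊤ := by
  let S : LieSubalgebra ℝ (FreeNilpotentLieAlgebra m p) :=
    { toSubmodule := Submodule.span ℝ (Set.range (gen m p)) ⊔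
        (lowerCentralSeries ℝ (FreeNilpotentLieAlgebra m p) _ 1).toSubmodule
      lie_mem' := fun {x y} _ _ => Submodule.mem_sup_right
        (lie_mem_lowerCentralSeries_succ (k := 0) x (by simp)) }
  let F : FreeLieAlgebra ℝ (Fin m) →ₗ⁅ℝ⁆ S := FreeLieAlgebra.lift ℝ fun i =>
    ⟨gen m p i, Submodule.mem_sup_left (Submodule.subset_span ⟨i, rfl⟩)⟩
  have hF : S.incl.comp F = mkHom m p := by
    refine FreeLieAlgebra.hom_ext fun i => ?_
    simp [F, gen]
  refine eq_top_iff.mpr fun y _ => ?_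
  obtain ⟨x, rfl⟩ := mkHom_surjective m p y
  rw [← hF]
  exact (F x).2

/-- Every assignment of the generators of a free nilpotent Lie algebra extends to a derivation:
on the free Lie algebra it is the `ε`-part of a homomorphism into the dual numbers, and it
respects the lower central series. -/
theorem exists_derivation (y : Fin m → FreeNilpotentLieAlgebra m p) :
    ∃ D : LieDerivation ℝ (FreeNilpotentLieAlgebra m p) (FreeNilpotentLieAlgebra m p),
      ∀ i, D (gen m p i) = y i := by
  let F : FreeLieAlgebra ℝ (Fin m) →ₗ⁅ℝ⁆ DualLieAlgebra (FreeNilpotentLieAlgebra m p) :=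
    FreeLieAlgebra.lift ℝ fun i => DualLieAlgebra.mk (gen m p i) (y i)
  have hF : (DualLieAlgebra.fstHom _).comp F = mkHom m p := by
    refine FreeLieAlgebra.hom_ext fun i => ?_
    change (F (FreeLieAlgebra.of ℝ i)).1 = gen m p i
    rw [FreeLieAlgebra.lift_of_apply]
    rfl
  have hF1 : ∀ a, (F a).1 = mkHom m p a := fun a => congrArg (fun G => G a) hF
  let d : FreeLieAlgebra ℝ (Fin m) →ₗ[ℝ] FreeNilpotentLieAlgebra m p :=
    { toFun := fun a => (F a).2
      map_add' := fun a b => by rw [map_add]; rfl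
      map_smul' := fun c a => by rw [map_smul]; rfl }
  have hd : ∀ a b, d ⁅a, b⁆ = ⁅mkHom m p a, d b⁆ + ⁅d a, mkHom m p b⁆ := by
    intro a b
    change (F ⁅a, b⁆).2 = ⁅mkHom m p a, (F b).2⁆ + ⁅(F a).2, mkHom m p b⁆
    rw [LieHom.map_lie, ← hF1, ← hF1]
    rfl
  have hlcs : ∀ k, ∀ a ∈ lowerCentralSeries ℝ (FreeLieAlgebra ℝ (Fin m)) _ k,
      d a ∈ lowerCentralSeries ℝ (FreeNilpotentLieAlgebra m p) _ k := by
    intro k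
    induction k with
    | zero => intro a _; simp
    | succ k ih =>
      intro a ha
      refine lowerCentralSeries_succ_le (W := (lowerCentralSeries ℝ
        (FreeNilpotentLieAlgebra m p) _ (k + 1)).toSubmodule.comap d) (fun u b hb => ?_) ha
      change d ⁅u, b⁆ ∈ lowerCentralSeries ℝ (FreeNilpotentLieAlgebra m p) _ (k + 1)
      rw [hd]
      refine add_mem (lie_mem_lowerCentralSeries_succ _ (ih b hb))
        (lie_mem_lowerCentralSeries_succ _ ?_)
      exact LieIdeal.map_lowerCentralSeries_le k (LieIdeal.mem_map hb)
  let dq : FreeNilpotentLieAlgebra m p →ₗ[ℝ] FreeNilpotentLieAlgebra m p :=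
    Submodule.liftQ _ d (fun a ha => by
      have h := hlcs p a ha
      rw [lowerCentralSeries_eq_bot] at h
      simpa using h)
  have hdq : ∀ a, dq (mkHom m p a) = d a := fun a => rfl
  refine ⟨⟨dq, fun a b => ?_⟩, fun i => ?_⟩
  · obtain ⟨a, rfl⟩ := mkHom_surjective m p a
    obtain ⟨b, rfl⟩ := mkHom_surjective m p b
    rw [← LieHom.map_lie, hdq, hdq, hdq, hd, ← lie_skew (d a), sub_eq_add_neg]
  · change (F (FreeLieAlgebra.of ℝ i)).2 = y i
    rw [FreeLieAlgebra.lift_of_apply]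
    rfl

end FreeNilpotentLieAlgebra

/-- A Lie algebra isomorphic to `𝔣(m, p)` has generators on which derivations can be prescribed
arbitrarily, and vanishing brackets of more than `p` elements. -/
theorem exists_free_generators {N : Type*} [LieRing N] [LieAlgebra ℝ N] {m p : ℕ}
    (E : N ≃ₗ⁅ℝ⁆ FreeNilpotentLieAlgebra m p) :
    ∃ x : Fin m → N,
      Submodule.span ℝ (Set.range x) ⊔ (lowerCentralSeries ℝ N N 1).toSubmodule = ⊤ ∧
      (∀ y : Fin m → N, ∃ D : LieDerivation ℝ N N, ∀ i, D (x i) = y i) ∧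
      lowerCentralSeries ℝ N N p = ⊥ := by
  refine ⟨fun i => E.symm (FreeNilpotentLieAlgebra.gen m p i), ?_, fun y => ?_, ?_⟩
  · refine eq_top_iff.mpr fun z _ => ?_
    have hz : E z ∈ Submodule.span ℝ (Set.range (FreeNilpotentLieAlgebra.gen m p)) ⊔
        (lowerCentralSeries ℝ (FreeNilpotentLieAlgebra m p) _ 1).toSubmodule := by
      rw [FreeNilpotentLieAlgebra.span_gen_sup_lowerCentralSeries_one]
      trivial
    obtain ⟨a, ha, b, hb, hab⟩ := Submodule.mem_sup.mp hz
    obtain ⟨c, rfl⟩ := (Submodule.mem_span_range_iff_exists_fun ℝ).mp ha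
    refine Submodule.mem_sup.mpr ⟨∑ i, c i • E.symm (FreeNilpotentLieAlgebra.gen m p i), ?_,
      E.symm b, ?_, ?_⟩
    · exact (Submodule.mem_span_range_iff_exists_fun ℝ).mpr ⟨c, rfl⟩
    · exact LieIdeal.map_lowerCentralSeries_le (f := E.symm.toLieHom) 1 (LieIdeal.mem_map hb)
    · have h : E.symm (E z) = z := E.symm_apply_apply z
      rw [← hab] at h
      rw [← h]
      change _ = E.symm.toLieHom _
      simp
  · obtain ⟨D, hD⟩ := FreeNilpotentLieAlgebra.exists_derivation m p (fun i => E (y i))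
    refine ⟨⟨E.symm.toLieHom.toLinearMap ∘ₗ D.toLinearMap ∘ₗ E.toLieHom.toLinearMap,
      fun a b => ?_⟩, fun i => ?_⟩
    · change E.symm (D (E ⁅a, b⁆)) = ⁅a, E.symm (D (E b))⁆ - ⁅b, E.symm (D (E a))⁆
      rw [LieEquiv.map_lie, LieDerivation.apply_lie_eq_sub]
      have h : ∀ u v, E.symm (⁅E u, v⁆) = ⁅u, E.symm v⁆ := by
        intro u v
        rw [LieEquiv.map_lie, LieEquiv.symm_apply_apply]
      rw [← h, ← h]
      exact map_sub E.symm.toLieHom _ _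
    · change E.symm (D (E (E.symm _))) = y i
      rw [LieEquiv.apply_symm_apply, hD, LieEquiv.symm_apply_apply]
  · rw [eq_bot_iff]
    intro z hz
    have h : E.toLieHom z ∈ lowerCentralSeries ℝ (FreeNilpotentLieAlgebra m p) _ p :=
      LieIdeal.map_lowerCentralSeries_le (f := E.toLieHom) p (LieIdeal.mem_map hz)
    rw [FreeNilpotentLieAlgebra.lowerCentralSeries_eq_bot] at h
    have h0 : E z = E 0 := ((LieSubmodule.mem_bot _).mp h).trans (map_zero E.toLieHom).symm
    exact (LieSubmodule.mem_bot _).mpr (E.injective h0)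

/-! ### Orthonormal bases adapted to a filtration -/

/-- A descending filtration of an inner product space has an orthonormal basis `b` with degrees
`w`, such that `b i` lies in the `w i`-th member and is orthogonal to the next one. -/
theorem exists_orthonormalBasis_adapted {V : Type*} [NormedAddCommGroup V]
    [InnerProductSpace ℝ V] [FiniteDimensional ℝ V] (F : ℕ → Submodule ℝ V) (hF : Antitone F)
    (hF0 : F 0 = ⊤) (q : ℕ) (hFq : F q = ⊥) :
    ∃ (b : OrthonormalBasis (Fin (Module.finrank ℝ V)) ℝ V) (w : Fin (Module.finrank ℝ V) → ℕ),
      (∀ i, b i ∈ F (w i)) ∧ ∀ i, ∀ x ∈ F (w i + 1), inner ℝ (b i) x = 0 := by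
  let W : Fin q → Submodule ℝ V := fun k => F k ⊓ (F (k + 1))ᗮ
  have horth : OrthogonalFamily ℝ (fun k => W k) fun k => (W k).subtypeₗᵢ := by
    have hlt : ∀ j k : Fin q, j < k → ∀ x ∈ W j, ∀ y ∈ W k, inner ℝ x y = 0 := by
      intro j k hjk x hx y hy
      exact Submodule.inner_left_of_mem_orthogonal (hF (Nat.succ_le_of_lt hjk) hy.1) hx.2
    intro j k hjk x y
    rcases lt_or_gt_of_ne hjk with h | h
    · exact hlt j k h x x.2 y y.2
    · rw [real_inner_comm]
      exact hlt k j h y y.2 x x.2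
  have hsup : ∀ d k, k + d = q → F k ≤ iSup W := by
    intro d
    induction d with
    | zero => intro k hk; rw [add_zero] at hk; rw [hk, hFq]; exact bot_le
    | succ d ih =>
      intro k hk x hx
      have h1 := ih (k + 1) (by omega)
      obtain ⟨y, hy, z, hz, rfl⟩ := (F (k + 1)).exists_add_mem_mem_orthogonal x
      have hyk : y ∈ F k := hF (Nat.le_succ k) hy
      refine add_mem (h1 hy) (Submodule.mem_iSup_of_mem (⟨k, by omega⟩ : Fin q) ⟨?_, hz⟩)
      exact (Submodule.add_mem_iff_right _ hyk).mp hx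
  have hint : DirectSum.IsInternal W := by
    rw [horth.isInternal_iff, Submodule.orthogonal_eq_bot_iff, eq_top_iff, ← hF0]
    exact hsup q 0 (zero_add q)
  refine ⟨hint.subordinateOrthonormalBasis rfl horth,
    fun i => (hint.subordinateOrthonormalBasisIndex rfl i horth : Fin q), fun i => ?_, fun i x hx => ?_⟩
  · exact (hint.subordinateOrthonormalBasis_subordinate rfl i horth).1
  · exact Submodule.inner_left_of_mem_orthogonal hx
      (hint.subordinateOrthonormalBasis_subordinate rfl i horth).2

theorem IsInnerProduct.exists_basis_adapted {V : Type*} [AddCommGroup V] [Module ℝ V]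
    [FiniteDimensional ℝ V] {B : LinearMap.BilinForm ℝ V} (hB : IsInnerProduct B)
    (F : ℕ → Submodule ℝ V) (hF : Antitone F) (hF0 : F 0 = ⊤) (q : ℕ) (hFq : F q = ⊥) :
    ∃ (b : Module.Basis (Fin (Module.finrank ℝ V)) ℝ V) (w : Fin (Module.finrank ℝ V) → ℕ),
      (∀ i j, B (b i) (b j) = if i = j then 1 else 0) ∧
      (∀ i, b i ∈ F (w i)) ∧ ∀ i k, ∀ x ∈ F k, w i < k → B x (b i) = 0 := by
  let core : InnerProductSpace.Core ℝ V :=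
    { inner := fun x y => B x y
      conj_inner_symm := fun x y => by simpa using hB.symm y x
      re_inner_nonneg := fun x => by
        by_cases hx : x = 0
        · simp [hx]
        · simpa using (hB.pos x hx).le
      add_left := fun x y z => by simp
      smul_left := fun x y r => by simp
      definite := fun x hx => by
        by_contra h
        exact (hB.pos x h).ne' hx }
  let _ : NormedAddCommGroup V := core.toNormedAddCommGroup
  let _ : InnerProductSpace ℝ V := InnerProductSpace.ofCore core.toCore
  obtain ⟨b, w, h1, h2⟩ := exists_orthonormalBasis_adapted F hF hF0 q hFq
  refine ⟨b.toBasis, w, fun i j => ?_, fun i => ?_, fun i k x hx hk => ?_⟩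
  · rw [b.coe_toBasis]
    exact orthonormal_iff_ite.mp b.orthonormal i j
  · rw [b.coe_toBasis]
    exact h1 i
  · rw [b.coe_toBasis, hB.symm]
    exact h2 i x (hF hk hx)

/-! ### The Ricci tensor of a metric Lie algebra -/

theorem Finset.sum_sum_eq_of_symm {ι : Type*} [Fintype ι] (F G : ι → ι → ℝ)
    (h : ∀ i j, F i j + F j i = G i j + G j i) : ∑ i, ∑ j, F i j = ∑ i, ∑ j, G i j := by
  have hF : ∑ i, ∑ j, (F i j + F j i) = 2 * ∑ i, ∑ j, F i j := by
    simp only [Finset.sum_add_distrib]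
    rw [Finset.sum_comm (f := fun i j => F j i), two_mul]
  have hG : ∑ i, ∑ j, (G i j + G j i) = 2 * ∑ i, ∑ j, G i j := by
    simp only [Finset.sum_add_distrib]
    rw [Finset.sum_comm (f := fun i j => G j i), two_mul]
  have := Finset.sum_congr rfl fun i (_ : i ∈ Finset.univ) =>
    Finset.sum_congr rfl fun j (_ : j ∈ Finset.univ) => h i j
  linarith

namespace MetricLieAlgebra

section Orthonormal

variable {V ι : Type*} [AddCommGroup V] [Module ℝ V] [Fintype ι] [DecidableEq ι]
  {B : LinearMap.BilinForm ℝ V} {b : Module.Basis ι ℝ V}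

theorem repr_eq_of_orthonormal (hb : ∀ i j, B (b i) (b j) = if i = j then 1 else 0) (x : V)
    (i : ι) : b.repr x i = B x (b i) := by
  have h : B (∑ j, b.repr x j • b j) (b i) = b.repr x i := by
    simp only [map_sum, map_smul, LinearMap.sum_apply, LinearMap.smul_apply, hb, smul_eq_mul]
    simp
  rw [← h, b.sum_repr]

theorem sum_smul_of_orthonormal (hb : ∀ i j, B (b i) (b j) = if i = j then 1 else 0) (x : V) :
    ∑ i, B x (b i) • b i = x := by
  conv_rhs => rw [← b.sum_repr x]
  simp only [repr_eq_of_orthonormal hb]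

theorem sum_mul_of_orthonormal
    (hb : ∀ i j, B (b i) (b j) = if i = j then 1 else 0) (x y : V) :
    ∑ i, B x (b i) * B y (b i) = B x y := by
  conv_rhs => rw [← sum_smul_of_orthonormal hb y]
  simp [mul_comm]

theorem sum_mul_apply_of_orthonormal
    (hb : ∀ i j, B (b i) (b j) = if i = j then 1 else 0) (A : V →ₗ[ℝ] V) (x y : V) :
    ∑ i, B x (b i) * B (A (b i)) y = B (A x) y := by
  conv_rhs => rw [← sum_smul_of_orthonormal hb x]
  simp

theorem trace_eq_of_orthonormal (hb : ∀ i j, B (b i) (b j) = if i = j then 1 else 0)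
    (A : V →ₗ[ℝ] V) : LinearMap.trace ℝ V A = ∑ i, B (A (b i)) (b i) := by
  rw [LinearMap.trace_eq_matrix_trace ℝ b, Matrix.trace]
  simp [LinearMap.toMatrix_apply, repr_eq_of_orthonormal hb]

end Orthonormal

variable {g ι : Type*} [LieRing g] [LieAlgebra ℝ g] [Fintype ι] [DecidableEq ι]
  {B : LinearMap.BilinForm ℝ g} {b : Module.Basis ι ℝ g}

theorem IsLeviCivita.koszul (hB : IsInnerProduct B) {D : g →ₗ[ℝ] g →ₗ[ℝ] g}
    (hD : IsLeviCivita B D) (X Y Z : g) :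
    2 * B (D X Y) Z = B ⁅X, Y⁆ Z - B ⁅Y, Z⁆ X + B ⁅Z, X⁆ Y := by
  have h1 := hD.metric X Y Z
  have h2 := hD.metric Y Z X
  have h3 := hD.metric Z X Y
  rw [← hD.torsion_free X Y, ← hD.torsion_free Y Z, ← hD.torsion_free Z X]
  simp only [map_sub, LinearMap.sub_apply]
  rw [hB.symm Y] at h1
  rw [hB.symm Z] at h2
  rw [hB.symm X] at h3
  linarith

theorem apply_lie_swap (X Y Z : g) : B ⁅X, Y⁆ Z = -B ⁅Y, X⁆ Z := by
  rw [← lie_skew, map_neg, LinearMap.neg_apply]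

/-- The Ricci curvature of a left-invariant metric in an orthonormal basis. Here `H` is the mean
curvature vector, which represents the functional `tr ad`. -/
theorem ricci_self_eq (hB : IsInnerProduct B)
    (hb : ∀ i j, B (b i) (b j) = if i = j then 1 else 0) {D : g →ₗ[ℝ] g →ₗ[ℝ] g}
    (hD : IsLeviCivita B D) {H : g} (hH : ∀ Y, B H Y = ∑ i, B ⁅Y, b i⁆ (b i)) (X : g) :
    ricci D X X = 1 / 4 * ∑ i, ∑ j, B ⁅b i, b j⁆ X ^ 2
      - 1 / 4 * ∑ i, ∑ j, (B ⁅X, b i⁆ (b j) + B ⁅X, b j⁆ (b i)) ^ 2 - B ⁅H, X⁆ X := by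
  -- The divergence of a left-invariant field `Y` is `-tr ad Y`.
  have hdiv : ∀ Y, ∑ i, B (D (b i) Y) (b i) = -B H Y := by
    intro Y
    rw [hH, ← Finset.sum_neg_distrib]
    refine Finset.sum_congr rfl fun i _ => ?_
    have h := hD.koszul hB (b i) Y (b i)
    rw [lie_self, map_zero, LinearMap.zero_apply, apply_lie_swap (b i) Y] at h
    linarith
  have hHX : B H (D X X) = B ⁅H, X⁆ X := by
    have h := hD.koszul hB X X H
    rw [lie_self, map_zero, LinearMap.zero_apply, apply_lie_swap X H] at h
    rw [hB.symm]
    linarith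
  have hterm : ∀ i, B (curvature D X X (b i)) (b i) = B (D (b i) (D X X)) (b i)
      + ∑ j, (B (D (b i) X) (b j) * (B (D (b i) X) (b j) + B ⁅X, b i⁆ (b j))
        + B ⁅X, b i⁆ (b j) * B (D (b j) X) (b i)) := by
    intro i
    have h1 : B (D X (D (b i) X)) (b i)
        = -∑ j, B (D (b i) X) (b j) * (B (D (b i) X) (b j) + B ⁅X, b i⁆ (b j)) := by
      have h := hD.metric X (D (b i) X) (b i)
      rw [← sum_mul_of_orthonormal hb (D (b i) X)] at h
      have h' : ∀ j, B (D X (b i)) (b j) = B (D (b i) X) (b j) + B ⁅X, b i⁆ (b j) := by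
        intro j
        rw [← hD.torsion_free, map_sub, LinearMap.sub_apply]
        ring
      simp only [h'] at h
      linarith
    have h2 : B (D ⁅b i, X⁆ X) (b i) = -∑ j, B ⁅X, b i⁆ (b j) * B (D (b j) X) (b i) := by
      rw [← lie_skew, map_neg, LinearMap.neg_apply, map_neg, LinearMap.neg_apply]
      exact congrArg Neg.neg (sum_mul_apply_of_orthonormal hb (D.flip X) ⁅X, b i⁆ (b i)).symm
    change B (D (b i) (D X X) - D X (D (b i) X) - D ⁅b i, X⁆ X) (b i) = _
    rw [map_sub, map_sub, LinearMap.sub_apply, LinearMap.sub_apply, h1, h2,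
      Finset.sum_add_distrib]
    ring
  -- The Koszul formula. Inserting it into the sum over `i` and `j`, the products of the symmetric
  -- factor `⟨[X, b i], b j⟩ + ⟨[X, b j], b i⟩` with the skew one `⟨[b i, b j], X⟩` cancel.
  have hT : ∀ i j, B (D (b i) X) (b j)
      = -(B ⁅X, b i⁆ (b j) + B ⁅X, b j⁆ (b i) + B ⁅b i, b j⁆ X) / 2 := by
    intro i j
    have h := hD.koszul hB (b i) X (b j)
    rw [apply_lie_swap (b i) X, apply_lie_swap (b j) (b i)] at h
    linarith
  rw [ricci, trace_eq_of_orthonormal hb, Finset.sum_congr rfl fun i _ => hterm i,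
    Finset.sum_add_distrib, hdiv, hHX, neg_add_eq_sub, Finset.mul_sum, Finset.mul_sum,
    ← Finset.sum_sub_distrib]
  congr 1
  simp only [Finset.mul_sum, ← Finset.sum_sub_distrib]
  refine Finset.sum_sum_eq_of_symm _ _ fun i j => ?_
  simp only [hT, apply_lie_swap (b j) (b i)]
  ring

/-- The polarized Einstein equation in an orthonormal basis. -/
theorem IsEinstein.exists_polarized (hB : IsInnerProduct B) (hE : IsEinstein B)
    (hb : ∀ i j, B (b i) (b j) = if i = j then 1 else 0) {H : g}
    (hH : ∀ Y, B H Y = ∑ i, B ⁅Y, b i⁆ (b i)) :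
    ∃ c : ℝ, ∀ X Y, c * B X Y = 1 / 4 * ∑ i, ∑ j, B ⁅b i, b j⁆ X * B ⁅b i, b j⁆ Y
      - 1 / 4 * ∑ i, ∑ j, (B ⁅X, b i⁆ (b j) + B ⁅X, b j⁆ (b i))
        * (B ⁅Y, b i⁆ (b j) + B ⁅Y, b j⁆ (b i))
      - 1 / 2 * (B ⁅H, X⁆ Y + B ⁅H, Y⁆ X) := by
  obtain ⟨D, hD, c, hc⟩ := hE
  refine ⟨c, fun X Y => ?_⟩
  have hX := (hc X X).symm.trans (ricci_self_eq hB hb hD hH X)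
  have hY := (hc Y Y).symm.trans (ricci_self_eq hB hb hD hH Y)
  have hXY := (hc (X + Y) (X + Y)).symm.trans (ricci_self_eq hB hb hD hH (X + Y))
  have h1 : ∑ i, ∑ j, B ⁅b i, b j⁆ (X + Y) ^ 2 = ∑ i, ∑ j, B ⁅b i, b j⁆ X ^ 2
      + 2 * ∑ i, ∑ j, B ⁅b i, b j⁆ X * B ⁅b i, b j⁆ Y + ∑ i, ∑ j, B ⁅b i, b j⁆ Y ^ 2 := by
    simp only [Finset.mul_sum, ← Finset.sum_add_distrib]
    refine Finset.sum_congr rfl fun i _ => Finset.sum_congr rfl fun j _ => ?_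
    rw [map_add]
    ring
  have h2 : ∑ i, ∑ j, (B ⁅X + Y, b i⁆ (b j) + B ⁅X + Y, b j⁆ (b i)) ^ 2
      = ∑ i, ∑ j, (B ⁅X, b i⁆ (b j) + B ⁅X, b j⁆ (b i)) ^ 2
      + 2 * ∑ i, ∑ j, (B ⁅X, b i⁆ (b j) + B ⁅X, b j⁆ (b i))
        * (B ⁅Y, b i⁆ (b j) + B ⁅Y, b j⁆ (b i))
      + ∑ i, ∑ j, (B ⁅Y, b i⁆ (b j) + B ⁅Y, b j⁆ (b i)) ^ 2 := by
    simp only [Finset.mul_sum, ← Finset.sum_add_distrib]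
    refine Finset.sum_congr rfl fun i _ => Finset.sum_congr rfl fun j _ => ?_
    simp only [add_lie, map_add, LinearMap.add_apply]
    ring
  rw [h1, h2] at hXY
  simp only [lie_add, map_add, LinearMap.add_apply] at hXY
  rw [hB.symm Y X] at hXY
  linarith

/-- Pairing the Einstein equation with the derivation `ad H`: the part of the Ricci tensor that
is the moment map of the bracket is orthogonal to derivations, and the Killing form does not
contribute, by the hypothesis `hK`, which holds because `ad H` takes values in the nilradical. -/
theorem sum_sq_symm_ad_eq (hB : IsInnerProduct B)
    (hb : ∀ i j, B (b i) (b j) = if i = j then 1 else 0) {H : g} {c : ℝ}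
    (hc : ∀ X Y, c * B X Y = 1 / 4 * ∑ i, ∑ j, B ⁅b i, b j⁆ X * B ⁅b i, b j⁆ Y
      - 1 / 4 * ∑ i, ∑ j, (B ⁅X, b i⁆ (b j) + B ⁅X, b j⁆ (b i))
        * (B ⁅Y, b i⁆ (b j) + B ⁅Y, b j⁆ (b i))
      - 1 / 2 * (B ⁅H, X⁆ Y + B ⁅H, Y⁆ X))
    (hK : ∀ k i, B ⁅b k, ⁅⁅H, b k⁆, b i⁆⁆ (b i) = 0) :
    ∑ k, ∑ l, (B ⁅H, b k⁆ (b l) + B ⁅H, b l⁆ (b k)) ^ 2 = -(4 * c) * ∑ k, B ⁅H, b k⁆ (b k) := by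
  have hsum : c * ∑ k, B ⁅H, b k⁆ (b k) = ∑ k, (1 / 4 * ∑ i, ∑ j, B ⁅b i, b j⁆ (b k)
        * B ⁅b i, b j⁆ ⁅H, b k⁆
      - 1 / 4 * ∑ i, ∑ j, (B ⁅b k, b i⁆ (b j) + B ⁅b k, b j⁆ (b i))
        * (B ⁅⁅H, b k⁆, b i⁆ (b j) + B ⁅⁅H, b k⁆, b j⁆ (b i))
      - 1 / 2 * (B ⁅H, b k⁆ ⁅H, b k⁆ + B ⁅H, ⁅H, b k⁆⁆ (b k))) := by
    rw [Finset.mul_sum]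
    refine Finset.sum_congr rfl fun k _ => ?_
    rw [← hc, hB.symm]
  have h1 : ∑ k, ∑ i, ∑ j, B ⁅b i, b j⁆ (b k) * B ⁅b i, b j⁆ ⁅H, b k⁆
      = 2 * ∑ i, ∑ j, B ⁅⁅H, b i⁆, b j⁆ ⁅b i, b j⁆ := by
    have hk : ∀ x, ∑ k, B x (b k) * B x ⁅H, b k⁆ = B ⁅H, x⁆ x := by
      intro x
      have h := sum_mul_apply_of_orthonormal hb (LieAlgebra.ad ℝ g H) x x
      rw [LieAlgebra.ad_apply] at h
      rw [← h]
      exact Finset.sum_congr rfl fun k _ => by rw [hB.symm x ⁅H, b k⁆]; rfl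
    rw [Finset.sum_comm]
    rw [Finset.sum_congr rfl fun i _ => Finset.sum_comm]
    simp only [hk, Finset.mul_sum]
    refine Finset.sum_sum_eq_of_symm _ _ fun i j => ?_
    have h2 : ∀ i j, B ⁅H, ⁅b i, b j⁆⁆ ⁅b i, b j⁆
        = B ⁅⁅H, b i⁆, b j⁆ ⁅b i, b j⁆ + B ⁅⁅H, b j⁆, b i⁆ ⁅b j, b i⁆ := by
      intro i j
      rw [leibniz_lie, map_add, LinearMap.add_apply]
      congr 1
      rw [← lie_skew (b i) ⁅H, b j⁆, ← lie_skew (b i) (b j)]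
      simp only [map_neg, LinearMap.neg_apply, neg_neg]
    rw [h2 i j, h2 j i]
    ring
  have h2 : ∀ k, ∑ i, ∑ j, (B ⁅b k, b i⁆ (b j) + B ⁅b k, b j⁆ (b i))
        * (B ⁅⁅H, b k⁆, b i⁆ (b j) + B ⁅⁅H, b k⁆, b j⁆ (b i))
      = 2 * ∑ j, B ⁅⁅H, b k⁆, b j⁆ ⁅b k, b j⁆ := by
    intro k
    have hkill : ∑ i, ∑ j, B ⁅⁅H, b k⁆, b i⁆ (b j) * B ⁅b k, b j⁆ (b i) = 0 := by
      refine Finset.sum_eq_zero fun i _ => ?_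
      have h := sum_mul_apply_of_orthonormal hb (LieAlgebra.ad ℝ g (b k)) ⁅⁅H, b k⁆, b i⁆ (b i)
      rw [LieAlgebra.ad_apply, hK] at h
      exact h
    have hsq : ∑ i, ∑ j, B ⁅⁅H, b k⁆, b i⁆ (b j) * B ⁅b k, b i⁆ (b j)
        = ∑ j, B ⁅⁅H, b k⁆, b j⁆ ⁅b k, b j⁆ :=
      Finset.sum_congr rfl fun i _ => sum_mul_of_orthonormal hb _ _
    have hsplit : ∑ i, ∑ j, (B ⁅b k, b i⁆ (b j) + B ⁅b k, b j⁆ (b i))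
        * (B ⁅⁅H, b k⁆, b i⁆ (b j) + B ⁅⁅H, b k⁆, b j⁆ (b i))
        = ∑ i, ∑ j, (2 * (B ⁅⁅H, b k⁆, b i⁆ (b j) * B ⁅b k, b i⁆ (b j))
          + 2 * (B ⁅⁅H, b k⁆, b i⁆ (b j) * B ⁅b k, b j⁆ (b i))) :=
      Finset.sum_sum_eq_of_symm _ _ fun i j => by ring
    rw [hsplit]
    simp only [Finset.sum_add_distrib, ← Finset.mul_sum]
    rw [hkill, hsq]
    ring
  have h3 : ∑ k, ∑ l, (B ⁅H, b k⁆ (b l) + B ⁅H, b l⁆ (b k)) ^ 2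
      = 2 * ∑ k, (B ⁅H, b k⁆ ⁅H, b k⁆ + B ⁅H, ⁅H, b k⁆⁆ (b k)) := by
    have hsplit : ∑ k, ∑ l, (B ⁅H, b k⁆ (b l) + B ⁅H, b l⁆ (b k)) ^ 2
        = ∑ k, ∑ l, 2 * (B ⁅H, b k⁆ (b l) * B ⁅H, b k⁆ (b l)
          + B ⁅H, b k⁆ (b l) * B ⁅H, b l⁆ (b k)) :=
      Finset.sum_sum_eq_of_symm _ _ fun i j => by ring
    rw [hsplit, Finset.mul_sum]
    refine Finset.sum_congr rfl fun k _ => ?_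
    rw [← Finset.mul_sum, Finset.sum_add_distrib, sum_mul_of_orthonormal hb]
    have h := sum_mul_apply_of_orthonormal hb (LieAlgebra.ad ℝ g H) ⁅H, b k⁆ (b k)
    simp only [LieAlgebra.ad_apply] at h
    rw [h]
  simp only [h2, Finset.sum_sub_distrib, ← Finset.mul_sum] at hsum
  rw [h1] at hsum
  linarith

end MetricLieAlgebra

/-! ### The filtration of a Lie algebra by the lower central series of an ideal -/

section IdealFiltration

variable {R g : Type*} [CommRing R] [LieRing g] [LieAlgebra R g]

/-- The derivation of an ideal given by bracketing with an element of the whole algebra. -/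
def LieIdeal.adDerivation (I : LieIdeal R g) (x : g) : LieDerivation R I I where
  toLinearMap := toEnd R g I x
  leibniz' a b := by
    ext
    change ⁅x, ⁅(a : g), (b : g)⁆⁆ = ⁅(a : g), ⁅x, (b : g)⁆⁆ - ⁅(b : g), ⁅x, (a : g)⁆⁆
    rw [leibniz_lie, ← lie_skew ⁅x, (a : g)⁆]
    abel

@[simp]
theorem LieIdeal.coe_adDerivation_apply (I : LieIdeal R g) (x : g) (y : I) :
    (I.adDerivation x y : g) = ⁅x, (y : g)⁆ := rfl

/-- The filtration of `g` which starts with `g` itself and continues with the lower central series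
of the ideal `I`, so that `I` is its member of index one. -/
def LieIdeal.lcsFiltration (I : LieIdeal R g) : ℕ → Submodule R g
  | 0 => ⊤
  | k + 1 => (lowerCentralSeries R I I k).toSubmodule.map I.toSubmodule.subtype

variable (I : LieIdeal R g)

theorem LieIdeal.mem_lcsFiltration_succ {k : ℕ} {x : g} :
    x ∈ I.lcsFiltration (k + 1) ↔ ∃ y ∈ lowerCentralSeries R I I k, (y : g) = x :=
  Iff.rfl

theorem LieIdeal.mem_lcsFiltration_one {x : g} : x ∈ I.lcsFiltration 1 ↔ x ∈ I :=
  ⟨fun ⟨y, _, hy⟩ => hy ▸ y.2, fun h => ⟨⟨x, h⟩, trivial, rfl⟩⟩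

theorem LieIdeal.lcsFiltration_antitone : Antitone I.lcsFiltration := by
  refine antitone_nat_of_succ_le fun k => ?_
  cases k with
  | zero => exact le_top
  | succ k => exact Submodule.map_mono (antitone_lowerCentralSeries R I I (Nat.le_succ k))

theorem LieIdeal.lie_mem_lcsFiltration {i j : ℕ} {x y : g} (hx : x ∈ I.lcsFiltration i)
    (hy : y ∈ I.lcsFiltration j) : ⁅x, y⁆ ∈ I.lcsFiltration (i + j) := by
  have h0 : ∀ (x : g) {y : g} {k : ℕ}, y ∈ I.lcsFiltration k → ⁅x, y⁆ ∈ I.lcsFiltration k := by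
    intro x y k hy
    cases k with
    | zero => trivial
    | succ k =>
      obtain ⟨y, hy, rfl⟩ := hy
      exact ⟨I.adDerivation x y, (I.adDerivation x).apply_mem_lowerCentralSeries hy, rfl⟩
  cases i with
  | zero => rw [zero_add]; exact h0 x hy
  | succ i =>
    cases j with
    | zero => rw [add_zero, ← lie_skew]; exact neg_mem (h0 y hx)
    | succ j =>
      obtain ⟨x, hx', rfl⟩ := I.mem_lcsFiltration_succ.mp hx
      obtain ⟨y, hy', rfl⟩ := I.mem_lcsFiltration_succ.mp hy
      have h := lie_mem_lowerCentralSeries_add hx' hy'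
      rw [show i + 1 + (j + 1) = i + j + 1 + 1 by omega]
      exact ⟨⁅x, y⁆, h, rfl⟩

end IdealFiltration

namespace MetricLieAlgebra

/-! ### Structure constants in an adapted orthonormal basis -/

/-- An orthonormal basis `b` of `g` whose members carry degrees `w` that describe their position
in the filtration of `g` by the lower central series of the ideal `I`. In particular, `w i = 0`
means that `b i` is orthogonal to `I`. -/
structure IsAdapted {g ι : Type*} [LieRing g] [LieAlgebra ℝ g] [DecidableEq ι]
    (B : LinearMap.BilinForm ℝ g) (I : LieIdeal ℝ g) (b : Module.Basis ι ℝ g) (w : ι → ℕ) :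
    Prop where
  orthonormal : ∀ i j, B (b i) (b j) = if i = j then 1 else 0
  mem : ∀ i, b i ∈ I.lcsFiltration (w i)
  apply_eq_zero : ∀ i k, ∀ x ∈ I.lcsFiltration k, w i < k → B x (b i) = 0

variable {g ι : Type*} [LieRing g] [LieAlgebra ℝ g] [DecidableEq ι]
  {B : LinearMap.BilinForm ℝ g} {I : LieIdeal ℝ g} {b : Module.Basis ι ℝ g} {w : ι → ℕ}

namespace IsAdapted

theorem lie_eq_zero_of_degree_eq_zero (hw : IsAdapted B I b w)
    (hI : ∀ x y : g, ⁅x, y⁆ ∈ I) (x y : g) {k : ι}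
    (hk : w k = 0) : B ⁅x, y⁆ (b k) = 0 :=
  hw.apply_eq_zero k 1 _ (I.mem_lcsFiltration_one.mpr (hI x y)) (by omega)

theorem lie_eq_zero_of_degree_lt (hw : IsAdapted B I b w)
    {i j k : ι} (h : w k < w i + w j) :
    B ⁅b i, b j⁆ (b k) = 0 :=
  hw.apply_eq_zero k _ _ (I.lie_mem_lcsFiltration (hw.mem i) (hw.mem j)) h

/-- The terms of the Killing form of `x ∈ I` vanish, because `ad x` raises degrees. -/
theorem killing_eq_zero (hw : IsAdapted B I b w)
    {x : g} (hx : x ∈ I) (y : g) (i : ι) : B ⁅y, ⁅x, b i⁆⁆ (b i) = 0 := by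
  have h1 := I.lie_mem_lcsFiltration (I.mem_lcsFiltration_one.mpr hx) (hw.mem i)
  have h2 := I.lie_mem_lcsFiltration (i := 0) (x := y) trivial h1
  exact hw.apply_eq_zero i _ _ h2 (by omega)

variable [Fintype ι]

/-- The Einstein equation paired with the diagonal operator with entries `u`, which is supported
on `I`: the Killing form does not contribute, and the moment map part becomes a weighted sum of
squares of structure constants. -/
theorem sum_weight_mul_sq_eq (hw : IsAdapted B I b w) {H : g} {c : ℝ}
    (hc : ∀ X Y, c * B X Y = 1 / 4 * ∑ i, ∑ j, B ⁅b i, b j⁆ X * B ⁅b i, b j⁆ Y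
      - 1 / 4 * ∑ i, ∑ j, (B ⁅X, b i⁆ (b j) + B ⁅X, b j⁆ (b i))
        * (B ⁅Y, b i⁆ (b j) + B ⁅Y, b j⁆ (b i))
      - 1 / 2 * (B ⁅H, X⁆ Y + B ⁅H, Y⁆ X))
    (u : ι → ℝ) (hu : ∀ k, w k = 0 → u k = 0) :
    ∑ i, ∑ j, ∑ k, (u k - u i - u j) * B ⁅b i, b j⁆ (b k) ^ 2
      = 4 * (c * ∑ k, u k + ∑ k, u k * B ⁅H, b k⁆ (b k)) := by
  have hk : ∀ k, 4 * (c * u k + u k * B ⁅H, b k⁆ (b k))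
      = ∑ i, ∑ j, u k * B ⁅b i, b j⁆ (b k) ^ 2 - ∑ i, ∑ j, 2 * (u k * B ⁅b k, b i⁆ (b j) ^ 2) := by
    intro k
    by_cases h0 : w k = 0
    · simp [hu k h0]
    have hkI : b k ∈ I := I.mem_lcsFiltration_one.mp
      (I.lcsFiltration_antitone (Nat.one_le_iff_ne_zero.mpr h0) (hw.mem k))
    have hkill : ∑ i, ∑ j, B ⁅b k, b i⁆ (b j) * B ⁅b k, b j⁆ (b i) = 0 := by
      refine Finset.sum_eq_zero fun i _ => ?_
      have h := sum_mul_apply_of_orthonormal hw.orthonormal (LieAlgebra.ad ℝ g (b k))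
        ⁅b k, b i⁆ (b i)
      rw [LieAlgebra.ad_apply, hw.killing_eq_zero hkI] at h
      exact h
    have hsplit : ∑ i, ∑ j, (B ⁅b k, b i⁆ (b j) + B ⁅b k, b j⁆ (b i))
        * (B ⁅b k, b i⁆ (b j) + B ⁅b k, b j⁆ (b i))
        = ∑ i, ∑ j, (2 * B ⁅b k, b i⁆ (b j) ^ 2
          + 2 * (B ⁅b k, b i⁆ (b j) * B ⁅b k, b j⁆ (b i))) :=
      Finset.sum_sum_eq_of_symm _ _ fun i j => by ring
    have h := hc (b k) (b k)
    rw [hw.orthonormal, if_pos rfl, hsplit] at h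
    simp only [Finset.sum_add_distrib, ← Finset.mul_sum, hkill, ← sq] at h
    simp only [← Finset.mul_sum]
    linear_combination 4 * u k * h
  have h1 : ∑ i, ∑ j, ∑ k, u k * B ⁅b i, b j⁆ (b k) ^ 2
      = ∑ k, ∑ i, ∑ j, u k * B ⁅b i, b j⁆ (b k) ^ 2 := by
    rw [Finset.sum_congr rfl fun i _ => Finset.sum_comm]
    exact Finset.sum_comm
  have h2 : ∑ i, ∑ j, ∑ k, (u i + u j) * B ⁅b i, b j⁆ (b k) ^ 2
      = ∑ i, ∑ j, ∑ k, 2 * (u i * B ⁅b i, b j⁆ (b k) ^ 2) := by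
    refine Finset.sum_sum_eq_of_symm _ _ fun i j => ?_
    simp only [← Finset.sum_add_distrib]
    refine Finset.sum_congr rfl fun k _ => ?_
    rw [apply_lie_swap (b j) (b i)]
    ring
  have h3 : ∑ i, ∑ j, ∑ k, (u k - u i - u j) * B ⁅b i, b j⁆ (b k) ^ 2
      = ∑ i, ∑ j, ∑ k, u k * B ⁅b i, b j⁆ (b k) ^ 2
        - ∑ i, ∑ j, ∑ k, (u i + u j) * B ⁅b i, b j⁆ (b k) ^ 2 := by
    simp only [← Finset.sum_sub_distrib]
    refine Finset.sum_congr rfl fun i _ => Finset.sum_congr rfl fun j _ =>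
      Finset.sum_congr rfl fun k _ => ?_
    ring
  rw [h3, h1, h2, ← Finset.sum_sub_distrib, Finset.mul_sum, ← Finset.sum_add_distrib,
    Finset.mul_sum]
  exact (Finset.sum_congr rfl fun k _ => hk k).symm

theorem lie_eq_zero_of_coeff_eq_zero (hw : IsAdapted B I b w) {x y : g}
    (h : ∀ k, B ⁅x, y⁆ (b k) = 0) : ⁅x, y⁆ = 0 := by
  rw [← sum_smul_of_orthonormal hw.orthonormal ⁅x, y⁆]
  simp [h]

theorem lie_eq_sum (hw : IsAdapted B I b w) (x y : g) :
    ⁅x, y⁆ = ∑ i, ∑ j, (B x (b i) * B y (b j)) • ⁅b i, b j⁆ := by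
  conv_lhs => rw [← sum_smul_of_orthonormal hw.orthonormal x,
    ← sum_smul_of_orthonormal hw.orthonormal y]
  rw [sum_lie]
  refine Finset.sum_congr rfl fun i _ => ?_
  rw [lie_sum]
  refine Finset.sum_congr rfl fun j _ => ?_
  rw [smul_lie, lie_smul, smul_smul]

/-! ### Standardness in the unimodular case -/

/-- In the unimodular case `H = 0` the Einstein constant is zero, the orthogonal complement of `I`
acts by skew-symmetric operators and `I` is abelian, so that the metric is standard. -/
theorem isStandard_of_unimodular (hB : IsInnerProduct B) (hw : IsAdapted B I b w)
    (hI : ∀ x y : g, ⁅x, y⁆ ∈ I) {c : ℝ}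
    (hc : ∀ X Y, c * B X Y = 1 / 4 * ∑ i, ∑ j, B ⁅b i, b j⁆ X * B ⁅b i, b j⁆ Y
      - 1 / 4 * ∑ i, ∑ j, (B ⁅X, b i⁆ (b j) + B ⁅X, b j⁆ (b i))
        * (B ⁅Y, b i⁆ (b j) + B ⁅Y, b j⁆ (b i))
      - 1 / 2 * (B ⁅(0 : g), X⁆ Y + B ⁅(0 : g), Y⁆ X)) :
    IsStandard B := by
  intro X hX Y hY
  by_cases hall : ∀ k, w k = 0
  · exact hw.lie_eq_zero_of_coeff_eq_zero fun k => hw.lie_eq_zero_of_degree_eq_zero hI _ _ (hall k)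
  obtain ⟨o, ho⟩ := not_forall.mp hall
  have hnonneg : 0 ≤ c := by
    have h := hw.sum_weight_mul_sq_eq hc (fun k => (w k : ℝ)) (fun k hk => by simp [hk])
    have hpos : 0 < ∑ k, (w k : ℝ) :=
      Finset.sum_pos' (fun k _ => Nat.cast_nonneg _)
        ⟨o, Finset.mem_univ _, Nat.cast_pos.mpr (Nat.pos_of_ne_zero ho)⟩
    have hge : 0 ≤ ∑ i, ∑ j, ∑ k, ((w k : ℝ) - w i - w j) * B ⁅b i, b j⁆ (b k) ^ 2 := by
      refine Finset.sum_nonneg fun i _ => Finset.sum_nonneg fun j _ =>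
        Finset.sum_nonneg fun k _ => ?_
      by_cases hlt : w k < w i + w j
      · rw [hw.lie_eq_zero_of_degree_lt hlt]
        simp
      · have : (w i : ℝ) + w j ≤ w k := by exact_mod_cast not_lt.mp hlt
        exact mul_nonneg (by linarith) (sq_nonneg _)
    rw [h] at hge
    simp only [zero_lie, map_zero, LinearMap.zero_apply, mul_zero, Finset.sum_const_zero,
      add_zero] at hge
    exact nonneg_of_mul_nonneg_left (by linarith) hpos
  -- For `b k` orthogonal to `I` the Einstein equation reads `c = -|S|²`, with `S` the symmetric part
  -- of `ad (b k)`, because `b k` is orthogonal to all brackets.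
  have hskew : ∀ k, w k = 0 → ∀ i j, B ⁅b k, b i⁆ (b j) + B ⁅b k, b j⁆ (b i) = 0 := by
    intro k hk
    have h := hc (b k) (b k)
    simp only [hw.lie_eq_zero_of_degree_eq_zero hI _ _ hk, ← sq, hw.orthonormal, if_true] at h
    have hle : ∑ i, ∑ j, (B ⁅b k, b i⁆ (b j) + B ⁅b k, b j⁆ (b i)) ^ 2 ≤ 0 := by
      simp at h
      linarith
    have h0 := le_antisymm hle
      (Finset.sum_nonneg fun i _ => Finset.sum_nonneg fun j _ => sq_nonneg _)
    intro i j
    have hi := (Finset.sum_eq_zero_iff_of_nonneg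
      (fun i _ => Finset.sum_nonneg fun j _ => sq_nonneg _)).mp h0 i (Finset.mem_univ i)
    have hj := (Finset.sum_eq_zero_iff_of_nonneg (fun j _ => sq_nonneg _)).mp hi j
      (Finset.mem_univ j)
    exact pow_eq_zero_iff two_ne_zero |>.mp hj
  have hcompl : ∀ i j, w i = 0 → w j = 0 → ⁅b i, b j⁆ = 0 := by
    intro i j hi hj
    refine hw.lie_eq_zero_of_coeff_eq_zero fun k => ?_
    have h := hskew i hi j k
    rwa [hw.lie_eq_zero_of_degree_eq_zero hI (b i) (b k) hj, add_zero] at h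
  -- With weight one on `I`, brackets inside `I` are the only ones that contribute, and they
  -- contribute with a negative sign.
  have hideal : ∀ i j, w i ≠ 0 → w j ≠ 0 → ⁅b i, b j⁆ = 0 := by
    let u : ι → ℝ := fun k => if w k = 0 then 0 else 1
    have h := hw.sum_weight_mul_sq_eq hc u (fun k hk => by simp [u, hk])
    have hu0 : 0 ≤ ∑ k, u k := Finset.sum_nonneg fun k _ => by
      simp only [u]
      split_ifs <;> norm_num
    have hle : ∀ i j k, 0 ≤ -((u k - u i - u j) * B ⁅b i, b j⁆ (b k) ^ 2) := by
      intro i j k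
      by_cases hij : w i = 0 ∧ w j = 0
      · simp [hcompl i j hij.1 hij.2]
      · have : u k - u i - u j ≤ 0 := by
          simp only [u]
          split_ifs <;> first | exact absurd ⟨‹w i = 0›, ‹w j = 0›⟩ hij | norm_num
        nlinarith [sq_nonneg (B ⁅b i, b j⁆ (b k))]
    have hsum : ∑ i, ∑ j, ∑ k, -((u k - u i - u j) * B ⁅b i, b j⁆ (b k) ^ 2) = 0 := by
      refine le_antisymm ?_ (Finset.sum_nonneg fun i _ => Finset.sum_nonneg fun j _ =>
        Finset.sum_nonneg fun k _ => hle i j k)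
      simp only [Finset.sum_neg_distrib, h]
      simp only [zero_lie, map_zero, LinearMap.zero_apply, mul_zero, Finset.sum_const_zero,
        add_zero]
      nlinarith
    intro i j hi hj
    refine hw.lie_eq_zero_of_coeff_eq_zero fun k => ?_
    have h1 := (Finset.sum_eq_zero_iff_of_nonneg (fun i _ => Finset.sum_nonneg fun j _ =>
      Finset.sum_nonneg fun k _ => hle i j k)).mp hsum i (Finset.mem_univ i)
    have h2 := (Finset.sum_eq_zero_iff_of_nonneg (fun j _ =>
      Finset.sum_nonneg fun k _ => hle i j k)).mp h1 j (Finset.mem_univ j)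
    have h3 := (Finset.sum_eq_zero_iff_of_nonneg (fun k _ => hle i j k)).mp h2 k
      (Finset.mem_univ k)
    have hne : u k - u i - u j ≠ 0 := by
      simp only [u, hi, hj, if_false]
      split_ifs <;> norm_num
    simpa [hne] using h3
  have hderived : ∀ x y : g, ⁅x, y⁆ ∈ (LieAlgebra.derivedSeries ℝ g 1).toSubmodule := fun x y =>
    LieSubmodule.lie_mem_lie (LieSubmodule.mem_top x) (LieSubmodule.mem_top y)
  have hkill : ∀ i, w i = 0 → ∀ Z ∈ B.orthogonal (LieAlgebra.derivedSeries ℝ g 1).toSubmodule,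
      ⁅b i, Z⁆ = 0 := by
    intro i hi Z hZ
    refine hw.lie_eq_zero_of_coeff_eq_zero fun k => ?_
    have h1 : B ⁅b i, Z⁆ (b k) = -B ⁅b i, b k⁆ Z := by
      refine (sum_mul_apply_of_orthonormal hw.orthonormal (LieAlgebra.ad ℝ g (b i)) Z
        (b k)).symm.trans ?_
      rw [hB.symm _ Z]
      conv_rhs => rw [← sum_smul_of_orthonormal hw.orthonormal ⁅b i, b k⁆]
      rw [map_sum, ← Finset.sum_neg_distrib]
      refine Finset.sum_congr rfl fun j _ => ?_
      rw [LieAlgebra.ad_apply, map_smul, smul_eq_mul, eq_neg_of_add_eq_zero_left (hskew i hi j k)]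
      ring
    rw [h1, neg_eq_zero]
    exact hZ _ (hderived _ _)
  have hterm : ∀ i j, (B X (b i) * B Y (b j)) • ⁅b i, b j⁆
      = (if w i = 0 then (B X (b i) * B Y (b j)) • ⁅b i, b j⁆ else 0)
        + (if w j = 0 then (B X (b i) * B Y (b j)) • ⁅b i, b j⁆ else 0) := by
    intro i j
    by_cases hi : w i = 0 <;> by_cases hj : w j = 0
    · simp [hcompl i j hi hj]
    · simp [hi, hj]
    · simp [hi, hj]
    · simp [hideal i j hi hj]
  rw [hw.lie_eq_sum, Finset.sum_congr rfl fun i _ => Finset.sum_congr rfl fun j _ => hterm i j]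
  simp only [Finset.sum_add_distrib]
  have hfirst : ∀ i, (∑ j, if w i = 0 then (B X (b i) * B Y (b j)) • ⁅b i, b j⁆ else 0) = 0 := by
    intro i
    split_ifs with hi
    · have h := hkill i hi Y hY
      rw [← sum_smul_of_orthonormal hw.orthonormal Y, lie_sum] at h
      simp only [lie_smul] at h
      simp only [← smul_smul, ← Finset.smul_sum, h, smul_zero]
    · simp
  have hsecond : ∀ j, (∑ i, if w j = 0 then (B X (b i) * B Y (b j)) • ⁅b i, b j⁆ else 0) = 0 := by
    intro j
    split_ifs with hj
    · have h : ⁅X, b j⁆ = 0 := by rw [← lie_skew, hkill j hj X hX, neg_zero]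
      rw [← sum_smul_of_orthonormal hw.orthonormal X, sum_lie] at h
      simp only [smul_lie] at h
      simp only [mul_comm (B X _), ← smul_smul, ← Finset.smul_sum, h, smul_zero]
    · simp
  rw [Finset.sum_congr rfl fun i _ => hfirst i, Finset.sum_comm,
    Finset.sum_congr rfl fun j _ => hsecond j]
  simp

/-! ### The mean curvature vector acts like the degree derivation -/

theorem sum_subtype_degree_ne_zero {ι : Type*} [Fintype ι] {w : ι → ℕ} (F : ι → ℝ)
    (hF : ∀ i, w i = 0 → F i = 0) :
    ∑ i : {i // w i ≠ 0}, F i = ∑ i, F i := by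
  rw [← Finset.sum_subtype (Finset.univ.filter fun i => w i ≠ 0) (by simp) F]
  exact Finset.sum_filter_of_ne fun i _ h h0 => h (hF i h0)

variable {g ι : Type*} [LieRing g] [LieAlgebra ℝ g] [Fintype ι] [DecidableEq ι]
  {B : LinearMap.BilinForm ℝ g} {I : LieIdeal ℝ g} {b : Module.Basis ι ℝ g} {w : ι → ℕ}

/-- If `I` is isomorphic to a free nilpotent Lie algebra, then the trace of an operator `ad x`
and its trace weighted by the degrees are determined by one number `t`, as if `ad x` were `t`
times the degree derivation of `I`. -/
theorem exists_trace_eq (hw : IsAdapted B I b w) (hI : ∀ x y : g, ⁅x, y⁆ ∈ I) {m p : ℕ}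
    (hm : 0 < m) (E : I ≃ₗ⁅ℝ⁆ FreeNilpotentLieAlgebra m p) (x : g) :
    ∃ t : ℝ, ∑ i, B ⁅x, b i⁆ (b i) = t * ∑ i, (w i : ℝ) ∧
      ∑ i, (w i : ℝ) * B ⁅x, b i⁆ (b i) = t * ∑ i, (w i : ℝ) ^ 2 := by
  obtain ⟨gen, hgen, hext, -⟩ := exists_free_generators E
  have : Nonempty (Fin m) := ⟨⟨0, hm⟩⟩
  have hmemI : ∀ i : {i // w i ≠ 0}, ∃ y : I, (y : g) = b i ∧
      y ∈ lowerCentralSeries ℝ I I (w i - 1) := by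
    intro i
    have h := hw.mem i
    rw [← Nat.succ_pred_eq_of_ne_zero i.2] at h
    obtain ⟨y, hy, hyb⟩ := I.mem_lcsFiltration_succ.mp h
    exact ⟨y, hyb, hy⟩
  choose e he hmem using hmemI
  let f : {i // w i ≠ 0} → I →ₗ[ℝ] ℝ := fun i => (B.flip (b i)).comp I.toSubmodule.subtype
  have hf : ∀ i y, f i y = B (y : g) (b i) := fun i y => rfl
  have hexp : ∀ y : I, ∑ i, f i y • e i = y := by
    intro y
    apply Subtype.ext
    have h1 : ((∑ i, f i y • e i : I) : g) = ∑ i : {i // w i ≠ 0}, B (y : g) (b i) • b i := by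
      refine (map_sum I.toSubmodule.subtype _ _).trans (Finset.sum_congr rfl fun i _ => ?_)
      rw [map_smul, hf, ← he]
      rfl
    rw [h1, ← Finset.sum_subtype (Finset.univ.filter fun i => w i ≠ 0) (by simp)
      (fun i => B (y : g) (b i) • b i)]
    conv_rhs => rw [← sum_smul_of_orthonormal hw.orthonormal (y : g)]
    refine Finset.sum_filter_of_ne fun i _ h h0 => h ?_
    rw [hw.apply_eq_zero i 1 y (I.mem_lcsFiltration_one.mpr y.2) (by omega), zero_smul]
  have hone : ∀ i, f i (e i) = 1 := by
    intro i
    rw [hf, he, hw.orthonormal, if_pos rfl]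
  have hvanish : ∀ (i : {i // w i ≠ 0}) (k : ℕ), ∀ y ∈ lowerCentralSeries ℝ I I k,
      w i - 1 < k → f i y = 0 := by
    intro i k y hy hk
    exact hw.apply_eq_zero i (k + 1) y (I.mem_lcsFiltration_succ.mpr ⟨y, hy, rfl⟩) (by omega)
  obtain ⟨t, ht⟩ := exists_weightedTrace_eq (v := fun i : {i // w i ≠ 0} => w i - 1)
    hexp hone hmem hvanish gen hgen hext (I.adDerivation x)
  have hv : ∀ i : {i // w i ≠ 0}, ((w i - 1 : ℕ) : ℝ) + 1 = w i := by
    intro i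
    exact_mod_cast Nat.sub_add_cancel (Nat.one_le_iff_ne_zero.mpr i.2)
  have hfi : ∀ i : {i // w i ≠ 0}, f i (I.adDerivation x (e i)) = B ⁅x, b i⁆ (b i) := by
    intro i
    rw [hf, LieIdeal.coe_adDerivation_apply, he]
  refine ⟨t, ?_, ?_⟩
  · have h := ht fun _ => 1
    simp only [one_mul, hv, hfi] at h
    rw [← sum_subtype_degree_ne_zero (w := w) (fun i => B ⁅x, b i⁆ (b i))
      (fun i hi => hw.lie_eq_zero_of_degree_eq_zero hI _ _ hi), h,
      sum_subtype_degree_ne_zero (w := w) (fun i => (w i : ℝ)) (fun i hi => by simp [hi])]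
  · have h := ht fun n => (n : ℝ) + 1
    simp only [hv, hfi, ← sq] at h
    rw [← sum_subtype_degree_ne_zero (w := w) (fun i => (w i : ℝ) * B ⁅x, b i⁆ (b i))
      (fun i hi => by simp [hi]), h,
      sum_subtype_degree_ne_zero (w := w) (fun i => (w i : ℝ) ^ 2) (fun i hi => by simp [hi])]

/-! ### Standardness when the mean curvature vector is nonzero -/

/-- The two pairings of the Einstein equation, with the degrees and with
`ad H`, bound the same quantity from both sides, so that equality holds throughout. Hence the
orthogonal complement of `I` is abelian and the symmetric part of `ad H` is `t` times the degree
operator, which makes `ad H` invertible on `I`. -/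
theorem isStandard_of_trace_eq [FiniteDimensional ℝ g] (hB : IsInnerProduct B)
    (hw : IsAdapted B I b w)
    (hI : ∀ x y : g, ⁅x, y⁆ ∈ I) {H : g} {c t : ℝ} (ht : 0 < t)
    (hc : ∀ X Y, c * B X Y = 1 / 4 * ∑ i, ∑ j, B ⁅b i, b j⁆ X * B ⁅b i, b j⁆ Y
      - 1 / 4 * ∑ i, ∑ j, (B ⁅X, b i⁆ (b j) + B ⁅X, b j⁆ (b i))
        * (B ⁅Y, b i⁆ (b j) + B ⁅Y, b j⁆ (b i))
      - 1 / 2 * (B ⁅H, X⁆ Y + B ⁅H, Y⁆ X))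
    (ht1 : ∑ i, B ⁅H, b i⁆ (b i) = t * ∑ i, (w i : ℝ))
    (ht2 : ∑ i, (w i : ℝ) * B ⁅H, b i⁆ (b i) = t * ∑ i, (w i : ℝ) ^ 2) :
    IsStandard B := by
  have hweight := hw.sum_weight_mul_sq_eq hc (fun k => (w k : ℝ)) (fun k hk => by simp [hk])
  have hnonneg : ∀ i j k, 0 ≤ ((w k : ℝ) - w i - w j) * B ⁅b i, b j⁆ (b k) ^ 2 := by
    intro i j k
    by_cases hlt : w k < w i + w j
    · rw [hw.lie_eq_zero_of_degree_lt hlt]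
      simp
    · have : (w i : ℝ) + w j ≤ w k := by exact_mod_cast not_lt.mp hlt
      exact mul_nonneg (by linarith) (sq_nonneg _)
  have hsymm := sum_sq_symm_ad_eq hB hw.orthonormal hc
    (fun k i => hw.killing_eq_zero (hI H (b k)) (b k) i)
  rw [ht1] at hsymm
  rw [ht2] at hweight
  -- Four times the squared distance of the symmetric part of `ad H` to `t` times the degree
  -- operator.
  have hdist : ∑ k, ∑ l, (B ⁅H, b k⁆ (b l) + B ⁅H, b l⁆ (b k)
        - if k = l then 2 * t * w k else 0) ^ 2
      = -t * ∑ i, ∑ j, ∑ k, ((w k : ℝ) - w i - w j) * B ⁅b i, b j⁆ (b k) ^ 2 := by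
    have hexpand : ∀ k, ∑ l, (B ⁅H, b k⁆ (b l) + B ⁅H, b l⁆ (b k)
        - if k = l then 2 * t * w k else 0) ^ 2
        = ∑ l, (B ⁅H, b k⁆ (b l) + B ⁅H, b l⁆ (b k)) ^ 2
          - 8 * t * ((w k : ℝ) * B ⁅H, b k⁆ (b k)) + 4 * t ^ 2 * (w k : ℝ) ^ 2 := by
      intro k
      have h : ∀ l, (B ⁅H, b k⁆ (b l) + B ⁅H, b l⁆ (b k) - if k = l then 2 * t * w k else 0) ^ 2
          = (B ⁅H, b k⁆ (b l) + B ⁅H, b l⁆ (b k)) ^ 2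
          + if k = l then -(8 * t * ((w k : ℝ) * B ⁅H, b k⁆ (b k))) + 4 * t ^ 2 * (w k : ℝ) ^ 2
            else 0 := by
        intro l
        split_ifs with hkl
        · subst hkl
          ring
        · ring
      simp only [h, Finset.sum_add_distrib, Finset.sum_ite_eq, Finset.mem_univ, if_true]
      ring
    simp only [hexpand, Finset.sum_add_distrib, Finset.sum_sub_distrib, ← Finset.mul_sum]
    rw [hsymm, hweight, ht2]
    ring
  have hsum0 : ∑ i, ∑ j, ∑ k, ((w k : ℝ) - w i - w j) * B ⁅b i, b j⁆ (b k) ^ 2 = 0 := by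
    refine le_antisymm ?_ (Finset.sum_nonneg fun i _ => Finset.sum_nonneg fun j _ =>
      Finset.sum_nonneg fun k _ => hnonneg i j k)
    have hsq : 0 ≤ ∑ k, ∑ l, (B ⁅H, b k⁆ (b l) + B ⁅H, b l⁆ (b k)
        - if k = l then 2 * t * w k else 0) ^ 2 :=
      Finset.sum_nonneg fun k _ => Finset.sum_nonneg fun l _ => sq_nonneg _
    rw [hdist] at hsq
    by_contra hlt
    have := mul_pos ht (not_le.mp hlt)
    linarith
  have hcompl : ∀ i j, w i = 0 → w j = 0 → ⁅b i, b j⁆ = 0 := by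
    intro i j hi hj
    refine hw.lie_eq_zero_of_coeff_eq_zero fun k => ?_
    have h1 := (Finset.sum_eq_zero_iff_of_nonneg (fun i _ => Finset.sum_nonneg fun j _ =>
      Finset.sum_nonneg fun k _ => hnonneg i j k)).mp hsum0 i (Finset.mem_univ i)
    have h2 := (Finset.sum_eq_zero_iff_of_nonneg (fun j _ =>
      Finset.sum_nonneg fun k _ => hnonneg i j k)).mp h1 j (Finset.mem_univ j)
    have h3 := (Finset.sum_eq_zero_iff_of_nonneg (fun k _ => hnonneg i j k)).mp h2 k
      (Finset.mem_univ k)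
    by_cases hk : w k = 0
    · exact hw.lie_eq_zero_of_degree_eq_zero hI _ _ hk
    · simpa [hi, hj, hk] using h3
  have hS : ∀ k l, B ⁅H, b k⁆ (b l) + B ⁅H, b l⁆ (b k) = if k = l then 2 * t * w k else 0 := by
    rw [hsum0, mul_zero] at hdist
    intro k l
    have h1 := (Finset.sum_eq_zero_iff_of_nonneg
      (fun k _ => Finset.sum_nonneg fun l _ => sq_nonneg _)).mp hdist k (Finset.mem_univ k)
    have h2 := (Finset.sum_eq_zero_iff_of_nonneg (fun l _ => sq_nonneg _)).mp h1 l
      (Finset.mem_univ l)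
    exact sub_eq_zero.mp (pow_eq_zero_iff two_ne_zero |>.mp h2)
  -- The quadratic form of `ad H` is positive definite on `I`, where all degrees are positive.
  have hquad : ∀ x, B ⁅H, x⁆ x = t * ∑ k, (w k : ℝ) * B x (b k) ^ 2 := by
    intro x
    have h1 : B ⁅H, x⁆ x = ∑ k, ∑ l, B x (b k) * B x (b l) * B ⁅H, b k⁆ (b l) := by
      refine (sum_mul_apply_of_orthonormal hw.orthonormal (LieAlgebra.ad ℝ g H) x x).symm.trans ?_
      refine Finset.sum_congr rfl fun k _ => ?_
      rw [LieAlgebra.ad_apply, ← sum_mul_of_orthonormal hw.orthonormal ⁅H, b k⁆ x, Finset.mul_sum]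
      exact Finset.sum_congr rfl fun l _ => by ring
    have h2 : ∑ k, ∑ l, B x (b k) * B x (b l) * B ⁅H, b k⁆ (b l)
        = ∑ k, ∑ l, if k = l then t * ((w k : ℝ) * B x (b k) ^ 2) else 0 := by
      refine Finset.sum_sum_eq_of_symm _ _ fun k l => ?_
      have h := hS k l
      by_cases hkl : k = l
      · subst hkl
        rw [if_pos rfl] at h
        simp only [if_true]
        linear_combination B x (b k) ^ 2 * h
      · rw [if_neg hkl] at h
        rw [if_neg hkl, if_neg (Ne.symm hkl)]
        linear_combination B x (b k) * B x (b l) * h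
    rw [h1, h2, Finset.mul_sum]
    simp
  have hinj : Function.Injective (I.adDerivation H).toLinearMap := by
    refine (injective_iff_map_eq_zero _).mpr fun y hy => Subtype.ext ?_
    have hy0 : ⁅H, (y : g)⁆ = 0 := congrArg Subtype.val hy
    have h := hquad y
    rw [hy0, map_zero, LinearMap.zero_apply, eq_comm, mul_eq_zero, or_iff_right ht.ne'] at h
    have hk := (Finset.sum_eq_zero_iff_of_nonneg
      (fun k _ => mul_nonneg (Nat.cast_nonneg (w k)) (sq_nonneg _))).mp h
    rw [← sum_smul_of_orthonormal hw.orthonormal (y : g)]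
    refine Finset.sum_eq_zero fun k hku => ?_
    by_cases hk0 : w k = 0
    · rw [hw.apply_eq_zero k 1 y (I.mem_lcsFiltration_one.mpr y.2) (by omega), zero_smul]
    · have hsq := (mul_eq_zero.mp (hk k hku)).resolve_left (Nat.cast_ne_zero.mpr hk0)
      rw [pow_eq_zero_iff two_ne_zero |>.mp hsq, zero_smul]
  have hsurj := LinearMap.surjective_of_injective hinj
  have horth : ∀ Z ∈ B.orthogonal (LieAlgebra.derivedSeries ℝ g 1).toSubmodule,
      ∀ i, w i ≠ 0 → B Z (b i) = 0 := by
    intro Z hZ i hi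
    have hbi : b i ∈ I := I.mem_lcsFiltration_one.mp
      (I.lcsFiltration_antitone (Nat.one_le_iff_ne_zero.mpr hi) (hw.mem i))
    obtain ⟨y, hy⟩ := hsurj ⟨b i, hbi⟩
    have hy' : ⁅H, (y : g)⁆ = b i := congrArg Subtype.val hy
    rw [hB.symm, ← hy']
    exact hZ _ (LieSubmodule.lie_mem_lie (LieSubmodule.mem_top H) (LieSubmodule.mem_top (y : g)))
  intro X hX Y hY
  rw [hw.lie_eq_sum]
  refine Finset.sum_eq_zero fun i _ => Finset.sum_eq_zero fun j _ => ?_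
  by_cases hi : w i = 0
  · by_cases hj : w j = 0
    · rw [hcompl i j hi hj, smul_zero]
    · rw [horth Y hY j hj, mul_zero, zero_smul]
  · rw [horth X hX i hi, zero_mul, zero_smul]

end IsAdapted

end MetricLieAlgebra

theorem theorem5 {g : Type*} [LieRing g] [LieAlgebra ℝ g] [FiniteDimensional ℝ g]
    [LieAlgebra.IsSolvable g] (B : LinearMap.BilinForm ℝ g) (hB : IsInnerProduct B)
    (hE : MetricLieAlgebra.IsEinstein B) (m p : ℕ) (hm : 2 ≤ m) (hp : 1 ≤ p)
    (hfree : Nonempty (lieNilradical ℝ g ≃ₗ⁅ℝ⁆ FreeNilpotentLieAlgebra m p)) :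
    MetricLieAlgebra.IsStandard B := by
  obtain ⟨E⟩ := hfree
  have hI : ∀ x y : g, ⁅x, y⁆ ∈ lieNilradical ℝ g := fun x y =>
    derivedSeries_one_le_lieNilradical
      (LieSubmodule.lie_mem_lie (LieSubmodule.mem_top x) (LieSubmodule.mem_top y))
  have hbot : (lieNilradical ℝ g).lcsFiltration (p + 1) = ⊥ := by
    obtain ⟨-, -, -, h⟩ := exists_free_generators E
    refine eq_bot_iff.mpr fun x hx => ?_
    obtain ⟨y, hy, rfl⟩ := LieIdeal.mem_lcsFiltration_succ _ |>.mp hx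
    rw [h, LieSubmodule.mem_bot] at hy
    simp [hy]
  obtain ⟨b, w, hb, hmem, hzero⟩ := hB.exists_basis_adapted (lieNilradical ℝ g).lcsFiltration
    (lieNilradical ℝ g).lcsFiltration_antitone rfl (p + 1) hbot
  have hw : MetricLieAlgebra.IsAdapted B (lieNilradical ℝ g) b w := ⟨hb, hmem, hzero⟩
  -- The mean curvature vector represents the functional `tr ad`.
  obtain ⟨H, hH⟩ : ∃ H : g, ∀ Y, B H Y = ∑ i, B ⁅Y, b i⁆ (b i) := by
    refine ⟨∑ k, (∑ i, B ⁅b k, b i⁆ (b i)) • b k, fun Y => ?_⟩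
    conv_rhs => rw [← MetricLieAlgebra.sum_smul_of_orthonormal hb Y]
    simp only [map_sum, map_smul, LinearMap.sum_apply, LinearMap.smul_apply, sum_lie, smul_lie,
      smul_eq_mul]
    rw [Finset.sum_comm]
    refine Finset.sum_congr rfl fun k _ => ?_
    rw [← Finset.mul_sum, hB.symm, mul_comm]
  obtain ⟨c, hc⟩ := hE.exists_polarized hB hb hH
  by_cases hH0 : H = 0
  · subst hH0
    exact hw.isStandard_of_unimodular hB hI hc
  · obtain ⟨t, ht1, ht2⟩ := hw.exists_trace_eq hI (by omega) E H
    have hpos := hB.pos H hH0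
    rw [hH, ht1] at hpos
    have ht : 0 < t :=
      pos_of_mul_pos_left hpos (Finset.sum_nonneg fun i _ => Nat.cast_nonneg _)
    exact hw.isStandard_of_trace_eq hB hI ht hc ht1 ht2
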